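/- **Proposition 3.1.** Let $X$ be a random vector of $\mathbb R^d$ with $\mathbb E\|X\|^2<\infty$, let $X_1,\dots,X_n$ be independent copies of $X$, and put $$G=\mathbb E(XX^\top),\quad N(\theta)=\mathbb E(\langle\theta,X\rangle^2)=\theta^\top G\theta,\quad \overline G=\frac1n\sum_{i=1}^nX_iX_i^\top,\quad \overline N(\theta)=\theta^\top\overline G\theta .$$ Assume that for some known constant $\kappa>1$ $$\sup\bigl\{\mathbb E(\langle\theta,X\rangle^4):\theta\in\mathbb R^d,\ \mathbb E(\langle\theta,X\rangle^2)\le1\bigr\}\le\kappa .$$ Let $\epsilon>0$, write $L=\log(\epsilon^{-1})+0.73\,d$, and define $$\lambda=\sqrt{\frac{2L}{(\kappa-1)n}},\qquad \mu=\sqrt{\frac{2(\kappa-1)L}{n}}+6.81\sqrt{\frac{2\kappa d}{n}},\qquad \widehat\delta=\frac{\mu}{1-2\mu},$$ and assume that the sample size satisfies $$n>\Bigl[20\sqrt{\kappa d}+\Bigl(\frac52+\frac1{2(\kappa-1)}\Bigr)\sqrt{2(\kappa-1)L}\Bigr]^2 .$$ Let $\psi:\mathbb R\to\mathbb R$ be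 the odd function with $\psi(z)=-\log(1-z+z^2/2)$ for $0\le z\le1$ and $\psi(z)=\log 2$ for $z\ge1$, and let $$\widehat N(\theta)=\inf\Bigl\{\rho>0:\ \sum_{i=1}^n\psi\bigl[\lambda(\rho^{-1}\langle\theta,X_i\rangle^2-1)\bigr]\le0\Bigr\}.$$ Let $R=\max_{i}\|G^{-1/2}X_i\|$, where $G^{-1/2}$ is the square root of the pseudo-inverse of $G$ (that is, $G^{-1/2}=U\,\mathrm{diag}(\mathbf 1(\lambda_i>0)\lambda_i^{-1/2})\,U^\top$ when $G=U\,\mathrm{diag}(\lambda_i)\,U^\top$ with $U$ orthogonal), and put $$\gamma_-=\frac{2L}{3(\kappa-1)n},\qquad \gamma_+=\frac{2L\,R^4(1+\widehat\delta)^2}{3(\kappa-1)n},$$ $$\overline\delta_+(\theta)=\frac{2L}{3(\kappa-1)n}\cdot\frac1n\sum_{i=1}^n\Bigl(\frac{\langle\theta,X_i\rangle^2}{\widehat N(\theta)}-1\Bigr)_+^3,\qquad \overline\delta_-(\theta)=\frac{2L}{3(\kappa-1)n}\cdot\frac1n\sum_{i=1}^n\Bigl(1-\frac{\langle\theta,X_i\rangle^2}{\widehat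 N(\theta)}\Bigr)_+^3 ,$$ where $z_+=\max\{z,0\}$. All quotients below and above are taken with the conventions $0/0=1$ and $z/0=+\infty$ for $z>0$. Then there is a measurable event of probability at least $1-2\epsilon$ on which, for every $\theta\in\mathbb R^d$, $$\overline\delta_+(\theta)\le\gamma_+\frac{\overline N(\theta)}{\widehat N(\theta)},\qquad \overline\delta_-(\theta)\le\gamma_-,$$ and $$-\frac{\widehat\delta+\gamma_-}{1+\widehat\delta}\le-\frac{\widehat\delta+\overline\delta_-(\theta)}{1+\widehat\delta}\le\frac{\overline N(\theta)}{N(\theta)}-1\le\frac{\widehat\delta+\overline\delta_+(\theta)}{(1-\widehat\delta)_+}\le\frac1{(1-\widehat\delta)_+(1-\gamma_+)_+}-1\le\frac{\widehat\delta+\gamma_+}{(1-\widehat\delta)_+(1-\gamma_+)_+}.$$ Moreover there is a numerical constant $C$ such that for all $d$, $n$, all $\kappa>1$ and all $\epsilon\in(0,1]$ satisfying the above condition on the sample size, $$\frac{\widehat\delta+\gamma_-}{1+\widehat\delta}\le C\,\frac{\kappa}{\kappa-1}\,\widehat\delta\qquad\text{and}\qquad \widehat\delta\le C\sqrt{\frac{\kappa\,[d+\log(\epsilon^{-1})]}{n}}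 .$$ In particular the left-hand bound is $O(\widehat\delta)$ as long as $\kappa$ stays bounded away from $1$. -/

import Mathlib

open MeasureTheory ProbabilityTheory Matrix

open scoped ENNReal RealInnerProductSpace

noncomputable section

namespace GramEstimation

/-! ### The distribution: energy, Gram matrix, pseudo-inverse square root, kurtosis -/

/-- The energy `N(θ) = 𝔼 ⟨θ, X⟩²` in direction `θ`, where `X` has distribution `P`. -/
def energy {d : ℕ} (P : Measure (EuclideanSpace ℝ (Fin d))) (θ : EuclideanSpace ℝ (Fin d)) : ℝ :=
  ∫ x, ⟪θ, x⟫ ^ 2 ∂P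

/-- The Gram matrix `G = 𝔼 (X Xᵀ)`. -/
def gram {d : ℕ} (P : Measure (EuclideanSpace ℝ (Fin d))) : Matrix (Fin d) (Fin d) ℝ :=
  Matrix.of fun j k => ∫ x, x j * x k ∂P

theorem gram_isHermitian {d : ℕ} (P : Measure (EuclideanSpace ℝ (Fin d))) :
    (gram P).IsHermitian := by
  ext j k
  simp [gram, mul_comm]

/-- `G^{-1/2} = U diag(1(λᵢ > 0) λᵢ^{-1/2}) Uᵀ`, where `G = U diag(λᵢ) Uᵀ` with `U` orthogonal. -/
def gramInvSqrt {d : ℕ} (P : Measure (EuclideanSpace ℝ (Fin d))) : Matrix (Fin d) (Fin d) ℝ :=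
  ((gram_isHermitian P).eigenvectorUnitary : Matrix (Fin d) (Fin d) ℝ) *
    Matrix.diagonal (fun i =>
      if 0 < (gram_isHermitian P).eigenvalues i
      then (√((gram_isHermitian P).eigenvalues i))⁻¹ else 0) *
    ((gram_isHermitian P).eigenvectorUnitary : Matrix (Fin d) (Fin d) ℝ)ᵀ

/-- `sup { 𝔼 ⟨θ, X⟩⁴ : θ ∈ ℝᵈ, 𝔼 ⟨θ, X⟩² ≤ 1 }`, an element of `[0, ∞]`. -/
def kurtosis {d : ℕ} (P : Measure (EuclideanSpace ℝ (Fin d))) : ℝ≥0∞ :=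
  ⨆ (θ : EuclideanSpace ℝ (Fin d)) (_ : energy P θ ≤ 1), ∫⁻ x, ENNReal.ofReal (⟪θ, x⟫ ^ 4) ∂P

/-! ### The deterministic constants -/

/-- `log(ε⁻¹) + 0.73 d`. -/
def confTerm (d : ℕ) (ε : ℝ) : ℝ := Real.log ε⁻¹ + 0.73 * d

/-- The scale parameter `λ`. -/
def scale (d n : ℕ) (κ ε : ℝ) : ℝ := √(2 / ((κ - 1) * n) * confTerm d ε)

/-- The constant `μ`. -/
def mu (d n : ℕ) (κ ε : ℝ) : ℝ :=
  √(2 * (κ - 1) / n * confTerm d ε) + 6.81 * √(2 * κ * d / n)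

/-- The sample size requirement. -/
def SampleSizeCondition (d n : ℕ) (κ ε : ℝ) : Prop :=
  (20 * √(κ * d) + (5 / 2 + 1 / (2 * (κ - 1))) * √(2 * (κ - 1) * confTerm d ε)) ^ 2 < (n : ℝ)

/-- `δ̂ = μ / (1 - 2μ)`. -/
def deltaHat (d n : ℕ) (κ ε : ℝ) : ℝ := mu d n κ ε / (1 - 2 * mu d n κ ε)

/-- `γ₋ = 2 [log(ε⁻¹) + 0.73 d] / (3 (κ - 1) n)`. -/
def gammaMinus (d n : ℕ) (κ ε : ℝ) : ℝ := 2 * confTerm d ε / (3 * (κ - 1) * n)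

/-! ### Quantities computed from a sample `X₁, …, Xₙ`

The realised sample is `x : Fin n → ℝᵈ`. -/

/-- The empirical Gram matrix `n⁻¹ ∑ᵢ Xᵢ Xᵢᵀ`. -/
def empGram {d n : ℕ} (x : Fin n → EuclideanSpace ℝ (Fin d)) : Matrix (Fin d) (Fin d) ℝ :=
  (n : ℝ)⁻¹ • ∑ i, Matrix.vecMulVec (x i).ofLp (x i).ofLp

/-- The empirical Gram form `N̄(θ) = θᵀ Ḡ θ`. -/
def empEnergy {d n : ℕ} (x : Fin n → EuclideanSpace ℝ (Fin d))
    (θ : EuclideanSpace ℝ (Fin d)) : ℝ :=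
  θ.ofLp ⬝ᵥ (empGram x *ᵥ θ.ofLp)

/-- The influence function on the non-negative half-line. -/
def psiPos (z : ℝ) : ℝ := if 1 ≤ z then Real.log 2 else -Real.log (1 - z + z ^ 2 / 2)

/-- The influence function `ψ`, extended from the half-line as an odd function. -/
def psi (z : ℝ) : ℝ := if 0 ≤ z then psiPos z else -psiPos (-z)

/-- The robust estimator
`N̂_λ(θ) = inf { ρ > 0 : ∑ᵢ ψ[λ (ρ⁻¹ ⟨θ, Xᵢ⟩² - 1)] ≤ 0 }` of `N(θ)`. -/
def robustEnergy {d n : ℕ} (lam : ℝ) (x : Fin n → EuclideanSpace ℝ (Fin d))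
    (θ : EuclideanSpace ℝ (Fin d)) : ℝ :=
  sInf {ρ : ℝ | 0 < ρ ∧ ∑ i, psi (lam * (ρ⁻¹ * ⟪θ, x i⟫ ^ 2 - 1)) ≤ 0}

/-- `R = maxᵢ ‖G^{-1/2} Xᵢ‖`. -/
def sampleRadius {d n : ℕ} (P : Measure (EuclideanSpace ℝ (Fin d)))
    (x : Fin n → EuclideanSpace ℝ (Fin d)) : ℝ :=
  ⨆ i, ‖WithLp.toLp 2 (gramInvSqrt P *ᵥ (x i).ofLp)‖

/-- `γ₊ = 2 [log(ε⁻¹) + 0.73 d] R⁴ (1 + δ̂)² / (3 (κ - 1) n)`. -/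
def gammaPlus {d n : ℕ} (P : Measure (EuclideanSpace ℝ (Fin d))) (κ ε : ℝ)
    (x : Fin n → EuclideanSpace ℝ (Fin d)) : ℝ :=
  2 * confTerm d ε * sampleRadius P x ^ 4 * (1 + deltaHat d n κ ε) ^ 2 / (3 * (κ - 1) * n)

/-- The quotient `a / b` of non-negative extended reals with the conventions `0 / 0 = 1` and
`z / 0 = +∞` for `z > 0`. -/
def ratio (a b : EReal) : EReal := if b = 0 then (if a = 0 then 1 else ⊤) else a / b

/-- `δ̄₊(θ) = (2 [log(ε⁻¹) + 0.73 d] / (3 (κ - 1) n)) · n⁻¹ ∑ᵢ (⟨θ, Xᵢ⟩² / N̂(θ) - 1)₊³`. -/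
def deltaBarPlus {d n : ℕ} (κ ε : ℝ) (x : Fin n → EuclideanSpace ℝ (Fin d))
    (θ : EuclideanSpace ℝ (Fin d)) : EReal :=
  ((2 * confTerm d ε / (3 * (κ - 1) * n) : ℝ) : EReal) * ((((n : ℝ)⁻¹ : ℝ) : EReal) *
    ∑ i, (max (ratio ((⟪θ, x i⟫ ^ 2 : ℝ) : EReal)
      (robustEnergy (scale d n κ ε) x θ : EReal) - 1) 0) ^ 3)

/-- `δ̄₋(θ) = (2 [log(ε⁻¹) + 0.73 d] / (3 (κ - 1) n)) · n⁻¹ ∑ᵢ (1 - ⟨θ, Xᵢ⟩² / N̂(θ))₊³`. -/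
def deltaBarMinus {d n : ℕ} (κ ε : ℝ) (x : Fin n → EuclideanSpace ℝ (Fin d))
    (θ : EuclideanSpace ℝ (Fin d)) : EReal :=
  ((2 * confTerm d ε / (3 * (κ - 1) * n) : ℝ) : EReal) * ((((n : ℝ)⁻¹ : ℝ) : EReal) *
    ∑ i, (max (1 - ratio ((⟪θ, x i⟫ ^ 2 : ℝ) : EReal)
      (robustEnergy (scale d n κ ε) x θ : EReal)) 0) ^ 3)

end GramEstimation

end

open GramEstimation

/-! The sum defining `robustEnergy` is non-increasing in ρ, so N̂(θ) is located between N(θ)/(1+δ̂)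
and N(θ)/(1-δ̂) (the latter if δ̂ < 1) by the sign of that sum at the two points. Both signs follow
from one PAC-Bayesian bound, used with c = λ and c = -λ and uniform in θ and ρ.

After whitening, y = G^{-1/2}X and η = ρ^{-1/2}G^{1/2}θ, so that ‖η‖² = N(θ)/ρ. The parameter η is
perturbed by Gaussian noise of variance τ². `psi_integral_le` replaces Jensen's inequality: ψ of the
mean loss is at most the Gaussian mean of log(1 + h + h²/2 + (15/2)v), where h is the perturbed loss
and v a proxy for its variance. For a fixed parameter u, the exponential of the sum of these
logarithms, normalised by its mean growth, has expectation at most 1. Averaging over centred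
Gaussian u, then Markov's inequality and a Gaussian change of measure of entropy ‖η‖²/(2τ²), give
`exists_measurableSet_sum_psi_le` for all η on a single event. The fourth moment bound κ and a
choice of τ² make the bound explicit (`pac_bound_le`), and the equation δ̂ = μ + 2μδ̂ is what gives
it the right sign at N(θ)/ρ = 1 ± δ̂.

The rest is deterministic. As z - z₊³/3 ≤ ψ(z) ≤ z + z₋³/3, the vanishing of the sum at N̂ places
N̄/N̂ - 1 between -δ̄₋ and δ̄₊ (`empEnergy_div_sub_one_le`, `one_sub_empEnergy_div_le`). Combined
with the location of N̂, this gives the chain for N̄/N (`ratio_chain`). If N(θ) = 0, almost every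
sample is orthogonal to θ and all quotients are 0/0 = 1. -/

namespace GramEstimation

/-! ### Bounds on the influence function ψ -/

section InfluenceFunction

theorem quad_pos (z : ℝ) : 0 < 1 + z + z ^ 2 / 2 := by nlinarith [sq_nonneg (z + 1)]

theorem half_le_quad (z : ℝ) : 1 / 2 ≤ 1 + z + z ^ 2 / 2 := by nlinarith [sq_nonneg (z + 1)]

theorem half_le_quad_neg (z : ℝ) : 1 / 2 ≤ 1 - z + z ^ 2 / 2 := by nlinarith [sq_nonneg (z - 1)]

/-- The constant branch is the value at 1 of the logarithmic one, so truncating the argument merges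
the two. Continuity, monotonicity and the bound by log 2 are read off this form. -/
theorem psiPos_eq_log (z : ℝ) : psiPos z = -Real.log (1 - min z 1 + min z 1 ^ 2 / 2) := by
  unfold psiPos
  split_ifs with h
  · rw [min_eq_right h, ← Real.log_inv]; norm_num
  · rw [min_eq_left (not_le.1 h).le]

theorem psiPos_zero : psiPos 0 = 0 := by simp [psiPos]

theorem psi_neg (z : ℝ) : psi (-z) = -psi z := by
  unfold psi
  rcases lt_trichotomy z 0 with h | h | h
  · rw [if_pos (by linarith), if_neg (by linarith), neg_neg]
  · simp [h, psiPos_zero]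
  · rw [if_neg (by linarith), if_pos h.le, neg_neg]

theorem psi_of_nonneg {z : ℝ} (hz : 0 ≤ z) : psi z = psiPos z := if_pos hz

theorem continuous_psiPos : Continuous psiPos := by
  have : psiPos = fun z => -Real.log (1 - min z 1 + min z 1 ^ 2 / 2) := funext psiPos_eq_log
  rw [this]
  refine (Continuous.log (by fun_prop) fun z => ?_).neg
  linarith [half_le_quad_neg (min z 1)]

theorem psi_eq (z : ℝ) : psi z = psiPos (max z 0) - psiPos (max (-z) 0) := by
  unfold psi
  split_ifs with h
  · rw [max_eq_left h, max_eq_right (by linarith), psiPos_zero, sub_zero]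
  · rw [max_eq_right (by linarith), max_eq_left (by linarith), psiPos_zero, zero_sub]

theorem continuous_psi : Continuous psi := by
  have : psi = fun z => psiPos (max z 0) - psiPos (max (-z) 0) := funext psi_eq
  rw [this]
  exact (continuous_psiPos.comp (by fun_prop)).sub (continuous_psiPos.comp (by fun_prop))

theorem monotoneOn_psiPos : MonotoneOn psiPos (Set.Ici 0) := by
  intro a _ b _ hab
  rw [psiPos_eq_log, psiPos_eq_log]
  refine neg_le_neg (Real.log_le_log (by linarith [half_le_quad_neg (min b 1)]) ?_)
  have h1 : min a 1 ≤ min b 1 := min_le_min_right 1 hab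
  nlinarith [min_le_right a 1, min_le_right b 1]

theorem psi_mono : Monotone psi := by
  intro a b hab
  rw [psi_eq, psi_eq]
  have h0 : ∀ c : ℝ, max c 0 ∈ Set.Ici 0 := fun c => le_max_right c 0
  have h1 := monotoneOn_psiPos (h0 a) (h0 b) (max_le_max_right 0 hab)
  have h2 := monotoneOn_psiPos (h0 (-b)) (h0 (-a)) (max_le_max_right 0 (neg_le_neg hab))
  linarith

theorem psiPos_le_log_two (z : ℝ) : psiPos z ≤ Real.log 2 := by
  rw [psiPos_eq_log, ← Real.log_inv]
  have := half_le_quad_neg (min z 1)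
  refine Real.log_le_log (by positivity) ?_
  rw [inv_le_comm₀ (by linarith) (by norm_num)]
  linarith

theorem psi_le_log_two (z : ℝ) : psi z ≤ Real.log 2 :=
  (psi_mono (le_max_left z 0)).trans
    ((psi_of_nonneg (le_max_right z 0)).trans_le (psiPos_le_log_two _))

theorem psi_zero : psi 0 = 0 := by rw [psi_of_nonneg le_rfl, psiPos_zero]

theorem psi_of_nonpos {z : ℝ} (hz : z ≤ 0) : psi z = -psiPos (-z) := by
  rw [← psi_of_nonneg (by linarith), psi_neg, neg_neg]

/-- For z ≥ 0, (1 - z + z²/2)(1 + z + z²/2) = 1 + z⁴/4 ≥ 1, used at min z 1. On [-1, 0] there is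
equality, and below -1 the quadratic stays above its minimum 1/2. -/
theorem psi_le_log_quad (z : ℝ) : psi z ≤ Real.log (1 + z + z ^ 2 / 2) := by
  rcases le_total 0 z with h | h
  · rw [psi_of_nonneg h, psiPos_eq_log, ← Real.log_inv]
    have h1 := half_le_quad_neg (min z 1)
    refine Real.log_le_log (by positivity) ?_
    rw [inv_le_iff_one_le_mul₀ (by linarith)]
    have h3 : 0 ≤ min z 1 := le_min h zero_le_one
    have h4 : 1 + min z 1 + min z 1 ^ 2 / 2 ≤ 1 + z + z ^ 2 / 2 := by
      have := min_le_left z 1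
      nlinarith
    nlinarith [sq_nonneg (min z 1 ^ 2)]
  · rw [psi_of_nonpos h, psiPos_eq_log, neg_neg]
    refine Real.log_le_log (by linarith [half_le_quad_neg (min (-z) 1)]) ?_
    rcases le_total (-z) 1 with h1 | h1
    · rw [min_eq_left h1]; nlinarith
    · rw [min_eq_right h1]; linarith [half_le_quad z]

theorem psi_le_self {z : ℝ} (hz : 0 ≤ z) : psi z ≤ z := by
  refine (psi_le_log_quad z).trans ?_
  rw [Real.log_le_iff_le_exp (quad_pos z)]
  exact Real.quadratic_le_exp_of_nonneg hz

/-- On [0, 1] the difference of the two sides has derivative x²(1-x)²/(2(1-x+x²/2)) ≥ 0. Beyond 1, ψ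
is constant while z - z³/3 decreases. -/
theorem sub_cube_le_psi {z : ℝ} (hz : 0 ≤ z) : z - z ^ 3 / 3 ≤ psi z := by
  have key : ∀ x ∈ Set.Icc (0 : ℝ) 1, 0 ≤ -Real.log (1 - x + x ^ 2 / 2) - x + x ^ 3 / 3 := by
    have hd : ∀ x : ℝ, HasDerivAt (fun x : ℝ => -Real.log (1 - x + x ^ 2 / 2) - x + x ^ 3 / 3)
        (x ^ 2 * (1 - x) ^ 2 / (2 * (1 - x + x ^ 2 / 2))) x := by
      intro x
      have hq : 1 - x + x ^ 2 / 2 ≠ 0 := by linarith [half_le_quad_neg x]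
      have h1 : HasDerivAt (fun x : ℝ => 1 - x + x ^ 2 / 2) (-1 + x) x := by
        have := ((hasDerivAt_id x).const_sub 1).add (((hasDerivAt_id x).pow 2).div_const 2)
        refine this.congr_deriv ?_
        simp
      have := ((h1.log hq).neg.sub (hasDerivAt_id x)).add (((hasDerivAt_id x).pow 3).div_const 3)
      refine this.congr_deriv ?_
      simp only [id]
      set A := 1 - x + x ^ 2 / 2 with hA
      field_simp
      push_cast
      rw [hA]
      ring
    have hm : MonotoneOn (fun x : ℝ => -Real.log (1 - x + x ^ 2 / 2) - x + x ^ 3 / 3)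
        (Set.Icc 0 1) := by
      refine monotoneOn_of_deriv_nonneg (convex_Icc 0 1)
        (fun x _ => (hd x).continuousAt.continuousWithinAt)
        (fun x _ => (hd x).differentiableAt.differentiableWithinAt) fun x _ => ?_
      rw [(hd x).deriv]
      have := half_le_quad_neg x
      positivity
    intro x hx
    have := hm (Set.left_mem_Icc.2 zero_le_one) hx hx.1
    simpa using this
  rw [psi_of_nonneg hz, psiPos_eq_log]
  rcases le_total z 1 with h | h
  · rw [min_eq_left h]; linarith [key z ⟨hz, h⟩]
  · rw [min_eq_right h]
    have := key 1 ⟨zero_le_one, le_rfl⟩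
    nlinarith [mul_nonneg (sub_nonneg.2 h) (sub_nonneg.2 h), mul_nonneg hz hz]

theorem sub_cube_posPart_le_psi (z : ℝ) : z - max z 0 ^ 3 / 3 ≤ psi z := by
  rcases le_total 0 z with h | h
  · rw [max_eq_left h]; exact sub_cube_le_psi h
  · have := psi_le_self (z := -z) (by linarith)
    rw [psi_neg] at this
    rw [max_eq_right h]; linarith

theorem psi_le_add_cube_negPart (z : ℝ) : psi z ≤ z + max (-z) 0 ^ 3 / 3 := by
  have := sub_cube_posPart_le_psi (-z)
  rw [psi_neg] at this
  linarith

/-- `log (1 + z + z² / 2)`, truncated at the level `1 + log 2`. -/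
noncomputable def logQuadTrunc (z : ℝ) : ℝ := min (Real.log (1 + z + z ^ 2 / 2)) (1 + Real.log 2)

/-- Adding z²/4 makes log(1 + z + z²/2) convex, and a convex function lies above its tangent at m.
-/
theorem log_quad_add_sq_tangent (m z : ℝ) :
    Real.log (1 + m + m ^ 2 / 2) + (1 + m) / (1 + m + m ^ 2 / 2) * (z - m) - (z - m) ^ 2 / 4 ≤
      Real.log (1 + z + z ^ 2 / 2) := by
  have hd : ∀ x : ℝ, HasDerivAt (fun x : ℝ => Real.log (1 + x + x ^ 2 / 2) + x ^ 2 / 4)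
      ((1 + x) / (1 + x + x ^ 2 / 2) + x / 2) x := by
    intro x
    have h1 : HasDerivAt (fun x : ℝ => 1 + x + x ^ 2 / 2) (1 + x) x := by
      have := ((hasDerivAt_id x).const_add 1).add (((hasDerivAt_id x).pow 2).div_const 2)
      refine this.congr_deriv ?_
      simp
    have := (h1.log (quad_pos x).ne').add (((hasDerivAt_id x).pow 2).div_const 4)
    refine this.congr_deriv ?_
    simp only [id]
    ring
  have hc : ConvexOn ℝ Set.univ (fun x : ℝ => Real.log (1 + x + x ^ 2 / 2) + x ^ 2 / 4) := by
    refine Monotone.convexOn_univ_of_deriv (fun x => (hd x).differentiableAt) ?_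
    have : deriv (fun x : ℝ => Real.log (1 + x + x ^ 2 / 2) + x ^ 2 / 4) =
        fun x => (1 + x) / (1 + x + x ^ 2 / 2) + x / 2 := funext fun x => (hd x).deriv
    rw [this]
    intro a b hab
    have ha := quad_pos a
    have hb := quad_pos b
    have : ((1 + b) / (1 + b + b ^ 2 / 2) + b / 2) - ((1 + a) / (1 + a + a ^ 2 / 2) + a / 2) =
        (b - a) * (4 + (a - b) ^ 2 + ((1 + a) * (1 + b) - 1) ^ 2) /
          (8 * (1 + b + b ^ 2 / 2) * (1 + a + a ^ 2 / 2)) := by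
      set A := 1 + a + a ^ 2 / 2 with hA
      set B := 1 + b + b ^ 2 / 2 with hB
      field_simp
      rw [hA, hB]
      ring
    have h2 : 0 ≤ (b - a) * (4 + (a - b) ^ 2 + ((1 + a) * (1 + b) - 1) ^ 2) /
          (8 * (1 + b + b ^ 2 / 2) * (1 + a + a ^ 2 / 2)) := by
      have : 0 ≤ b - a := sub_nonneg.2 hab
      positivity
    simp only
    linarith
  have hs : Real.log (1 + m + m ^ 2 / 2) + m ^ 2 / 4 +
      ((1 + m) / (1 + m + m ^ 2 / 2) + m / 2) * (z - m) ≤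
      Real.log (1 + z + z ^ 2 / 2) + z ^ 2 / 4 := by
    rcases lt_trichotomy m z with h | h | h
    · have := hc.le_slope_of_hasDerivAt (Set.mem_univ m) (Set.mem_univ z) h (hd m)
      rw [slope_def_field, le_div_iff₀ (sub_pos.2 h)] at this
      linarith
    · simp [h]
    · have := hc.slope_le_of_hasDerivAt (Set.mem_univ z) (Set.mem_univ m) h (hd m)
      rw [slope_def_field, div_le_iff₀ (sub_pos.2 h)] at this
      linarith
  nlinarith

/-- The slope p satisfies p² ≤ 1, because (1+m+m²/2)² - (1+m)² = (m(m+2))²/4. Hence p s - s²/4 ≤ p²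
≤ 1, and with ψ(m) ≤ log 2 this explains the truncation level 1 + log 2. -/
theorem psi_add_tangent_le (m z : ℝ) :
    psi m + (1 + m) / (1 + m + m ^ 2 / 2) * (z - m) - (z - m) ^ 2 / 4 ≤ logQuadTrunc z := by
  refine le_min ?_ ?_
  · linarith [log_quad_add_sq_tangent m z, psi_le_log_quad m]
  · have hq := quad_pos m
    have hp : ((1 + m) / (1 + m + m ^ 2 / 2)) ^ 2 ≤ 1 := by
      rw [div_pow, div_le_one (by positivity)]
      nlinarith [sq_nonneg (m * (m + 2))]
    nlinarith [psi_le_log_two m, sq_nonneg ((1 + m) / (1 + m + m ^ 2 / 2) - (z - m) / 2)]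

theorem neg_log_two_le_logQuadTrunc (z : ℝ) : -Real.log 2 ≤ logQuadTrunc z := by
  refine le_min ?_ (by linarith [Real.log_pos one_lt_two])
  rw [← Real.log_inv]
  exact Real.log_le_log (by norm_num) (by linarith [half_le_quad z])

theorem abs_logQuadTrunc_le (z : ℝ) : |logQuadTrunc z| ≤ 1 + Real.log 2 :=
  abs_le.2 ⟨by linarith [neg_log_two_le_logQuadTrunc z], min_le_right _ _⟩

theorem continuous_logQuadTrunc : Continuous logQuadTrunc :=
  (Continuous.log (by fun_prop) fun z => (quad_pos z).ne').min continuous_const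

end InfluenceFunction

/-! ### A Jensen-type inequality with a variance penalty -/

section PerturbedJensen

/-- The chord of exp over [0, 4 log 2] rises from 1 to 16, so its slope in x is 15/(2 log 2) < 11.
-/
theorem exp_two_mul_le {x : ℝ} (hx : 0 ≤ x) (hx' : x ≤ 2 * Real.log 2) :
    Real.exp (2 * x) ≤ 1 + 11 * x := by
  have hl := Real.log_two_gt_d9
  have hlpos : 0 < 4 * Real.log 2 := by linarith
  have h16 : Real.exp (4 * Real.log 2) = 16 := by
    rw [mul_comm, Real.exp_mul, Real.exp_log two_pos]; norm_num
  have hs : 0 ≤ 2 * x / (4 * Real.log 2) := by positivity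
  have hs' : 2 * x / (4 * Real.log 2) ≤ 1 := by rw [div_le_one hlpos]; linarith
  have := convexOn_exp.2 (Set.mem_univ 0) (Set.mem_univ (4 * Real.log 2)) (sub_nonneg.2 hs') hs
    (by ring)
  simp only [smul_eq_mul, mul_zero, zero_add, Real.exp_zero, mul_one, h16,
    div_mul_cancel₀ _ hlpos.ne'] at this
  have h2 : 15 * (2 * x / (4 * Real.log 2)) ≤ 11 * x := by
    rw [← mul_div_assoc, div_le_iff₀ hlpos]
    nlinarith
  linarith

/-- Truncation gives exp(`logQuadTrunc z`) ≤ 2e, and 2e · 11/8 < 15/2: this fixes the constant 15/2.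
-/
theorem logQuadTrunc_add_log_le {z v : ℝ} (hv : 0 ≤ v) :
    logQuadTrunc z + Real.log (1 + 11 / 8 * v) ≤
      Real.log (1 + z + z ^ 2 / 2 + 15 / 2 * v) := by
  have hq := quad_pos z
  rw [Real.le_log_iff_exp_le (by positivity), Real.exp_add, Real.exp_log (by positivity)]
  have h1 : Real.exp (logQuadTrunc z) ≤ 1 + z + z ^ 2 / 2 := by
    rw [← Real.le_log_iff_exp_le hq]; exact min_le_left _ _
  have h2 : Real.exp (logQuadTrunc z) ≤ Real.exp 1 * 2 := by
    have := Real.exp_le_exp.2 (min_le_right (Real.log (1 + z + z ^ 2 / 2)) (1 + Real.log 2))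
    rwa [Real.exp_add, Real.exp_log two_pos] at this
  have h3 := Real.exp_one_lt_d9
  nlinarith

variable {W : Type*} [MeasurableSpace W] {ν : Measure W}

theorem integrable_log_quad_add [IsFiniteMeasure ν] {h v : W → ℝ} (hh : MemLp h 2 ν)
    (hv : Integrable v ν) (hv0 : ∀ w, 0 ≤ v w) :
    Integrable (fun w => Real.log (1 + h w + h w ^ 2 / 2 + v w)) ν := by
  have hq : Integrable (fun w => 1 + h w + h w ^ 2 / 2 + v w) ν :=
    (((integrable_const 1).add (hh.integrable one_le_two)).add (hh.integrable_sq.div_const 2)).add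
      hv
  refine (hq.abs.add (integrable_const (Real.log 2))).mono'
    (Real.measurable_log.comp_aemeasurable hq.aemeasurable).aestronglyMeasurable
    (Filter.Eventually.of_forall fun w => ?_)
  have h1 := half_le_quad (h w)
  have h2 := hv0 w
  have h3 : 1 / 2 ≤ 1 + h w + h w ^ 2 / 2 + v w := by linarith
  have h4 := Real.log_le_sub_one_of_pos (x := 1 + h w + h w ^ 2 / 2 + v w) (by linarith)
  have h5 : -Real.log 2 ≤ Real.log (1 + h w + h w ^ 2 / 2 + v w) := by
    rw [← Real.log_inv]
    exact Real.log_le_log (by norm_num) (by linarith)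
  have h6 := Real.log_pos one_lt_two
  simp only [Real.norm_eq_abs, Pi.add_apply]
  rw [abs_le]
  have h7 := le_abs_self (1 + h w + h w ^ 2 / 2 + v w)
  constructor <;> linarith

theorem integrable_logQuadTrunc [IsFiniteMeasure ν] {h : W → ℝ} (hh : AEStronglyMeasurable h ν) :
    Integrable (fun w => logQuadTrunc (h w)) ν :=
  (integrable_const (1 + Real.log 2)).mono'
    (continuous_logQuadTrunc.comp_aestronglyMeasurable hh)
    (Filter.Eventually.of_forall fun w => abs_logQuadTrunc_le (h w))

/-- Two bounds on the Jensen defect: integrating the tangent inequality at the mean gives V/4, while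
ψ ≤ log 2 and `logQuadTrunc` ≥ -log 2 give 2 log 2. Since the minimum is bounded, it can be
dominated by a logarithm. -/
theorem psi_integral_le_add_min [IsProbabilityMeasure ν] {h : W → ℝ} (hh : MemLp h 2 ν) {V : ℝ}
    (hV : ∫ w, (h w - ∫ w, h w ∂ν) ^ 2 ∂ν ≤ V) :
    psi (∫ w, h w ∂ν) ≤ ∫ w, logQuadTrunc (h w) ∂ν + min (2 * Real.log 2) (V / 4) := by
  set m := ∫ w, h w ∂ν with hm
  have hgt := integrable_logQuadTrunc hh.aestronglyMeasurable
  have hi : Integrable h ν := hh.integrable one_le_two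
  have hsq : Integrable (fun w => (h w - m) ^ 2) ν := (hh.sub (memLp_const m)).integrable_sq
  rw [← sub_le_iff_le_add']
  refine le_min ?_ ?_
  · have : ∫ _w, -Real.log 2 ∂ν ≤ ∫ w, logQuadTrunc (h w) ∂ν :=
      integral_mono (integrable_const _) hgt fun w => neg_log_two_le_logQuadTrunc (h w)
    simp only [integral_const, probReal_univ, one_smul] at this
    linarith [psi_le_log_two m]
  · have hl : Integrable (fun w => (1 + m) / (1 + m + m ^ 2 / 2) * (h w - m)) ν :=
      (hi.sub (integrable_const m)).const_mul _
    have hl' : Integrable (fun w => psi m + (1 + m) / (1 + m + m ^ 2 / 2) * (h w - m)) ν :=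
      (integrable_const _).add hl
    have h1 := integral_mono (hl'.sub (hsq.div_const 4)) hgt
      fun w => psi_add_tangent_le m (h w)
    have h2 : ∫ w, (psi m + (1 + m) / (1 + m + m ^ 2 / 2) * (h w - m) - (h w - m) ^ 2 / 4) ∂ν =
        psi m - (∫ w, (h w - m) ^ 2 ∂ν) / 4 := by
      rw [integral_sub hl' (hsq.div_const 4),
        integral_add (integrable_const _) hl, integral_const_mul,
        integral_sub hi (integrable_const m), integral_div]
      simp [← hm]
    have h3 : psi m - (∫ w, (h w - m) ^ 2 ∂ν) / 4 ≤ ∫ w, logQuadTrunc (h w) ∂ν := h2 ▸ h1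
    linarith

/-- A substitute for Jensen's inequality for the non-convex function `log (1 + z + z² / 2)`:
`ψ (∫ h)` is controlled by an average at the price of a variance term `v`, which is only required
to dominate the variance of `h` after symmetrisation. -/
theorem psi_integral_le [IsProbabilityMeasure ν] {h v : W → ℝ} (hh : MemLp h 2 ν)
    (hv : Integrable v ν) (hv0 : ∀ w, 0 ≤ v w) {σ : W → W} (hσ : MeasurePreserving σ ν ν) {V : ℝ}
    (hV : ∫ w, (h w - ∫ w, h w ∂ν) ^ 2 ∂ν ≤ V) (hvV : ∀ w, 2 * V ≤ v w + v (σ w)) :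
    psi (∫ w, h w ∂ν) ≤ ∫ w, Real.log (1 + h w + h w ^ 2 / 2 + 15 / 2 * v w) ∂ν := by
  have hV0 : 0 ≤ V := (integral_nonneg fun w => sq_nonneg _).trans hV
  have hlog : Integrable (fun w => Real.log (1 + 11 / 8 * v w)) ν := by
    refine (hv.const_mul (11 / 8)).mono' (Real.measurable_log.comp_aemeasurable
      ((hv.aemeasurable.const_mul _).const_add 1)).aestronglyMeasurable
      (Filter.Eventually.of_forall fun w => ?_)
    have h0 := hv0 w
    have := Real.log_le_sub_one_of_pos (x := 1 + 11 / 8 * v w) (by positivity)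
    rw [Real.norm_eq_abs, abs_of_nonneg (Real.log_nonneg (by linarith))]
    linarith
  have hlogσ : Integrable (fun w => Real.log (1 + 11 / 8 * v (σ w))) ν :=
    hσ.integrable_comp_of_integrable hlog
  -- With x the minimum, e^{2x} ≤ 1 + 11x ≤ 1 + 11V/4. The factor 1/2 anticipates averaging over w
  -- and σ w.
  have hmin : min (2 * Real.log 2) (V / 4) ≤ 1 / 2 * Real.log (1 + 11 / 4 * V) := by
    have h0 : 0 ≤ min (2 * Real.log 2) (V / 4) :=
      le_min (by linarith [Real.log_pos one_lt_two]) (by linarith)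
    have h1 := exp_two_mul_le h0 (min_le_left _ _)
    have h2 : Real.exp (2 * min (2 * Real.log 2) (V / 4)) ≤ 1 + 11 / 4 * V := by
      linarith [min_le_right (2 * Real.log 2) (V / 4)]
    rw [← Real.le_log_iff_exp_le (by positivity)] at h2
    linarith
  -- (1 + 11a/8)(1 + 11b/8) ≥ 1 + 11(a+b)/8 ≥ 1 + 11V/4 for a = v w, b = v (σ w); since σ preserves
  -- ν, both logarithms have the same mean.
  have hsym : 1 / 2 * Real.log (1 + 11 / 4 * V) ≤ ∫ w, Real.log (1 + 11 / 8 * v w) ∂ν := by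
    have h1 : ∫ w, Real.log (1 + 11 / 8 * v (σ w)) ∂ν = ∫ w, Real.log (1 + 11 / 8 * v w) ∂ν := by
      have hm := hσ.map_eq
      rw [← integral_map (φ := σ) (f := fun w => Real.log (1 + 11 / 8 * v w))
        hσ.measurable.aemeasurable (by rw [hm]; exact hlog.aestronglyMeasurable), hm]
    have h2 : ∫ _w, Real.log (1 + 11 / 4 * V) ∂ν ≤
        ∫ w, (Real.log (1 + 11 / 8 * v w) + Real.log (1 + 11 / 8 * v (σ w))) ∂ν := by
      refine integral_mono (integrable_const _) (hlog.add hlogσ) fun w => ?_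
      have ha := hv0 w
      have hb := hv0 (σ w)
      simp only
      rw [← Real.log_mul (by positivity) (by positivity)]
      refine Real.log_le_log (by positivity) ?_
      nlinarith [hvV w, mul_nonneg ha hb]
    rw [integral_add hlog hlogσ, h1, integral_const, probReal_univ, one_smul] at h2
    linarith
  have hfin : ∫ w, logQuadTrunc (h w) ∂ν + ∫ w, Real.log (1 + 11 / 8 * v w) ∂ν ≤
      ∫ w, Real.log (1 + h w + h w ^ 2 / 2 + 15 / 2 * v w) ∂ν := by
    have hgt := integrable_logQuadTrunc hh.aestronglyMeasurable
    rw [← integral_add hgt hlog]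
    exact integral_mono (hgt.add hlog)
      (integrable_log_quad_add hh (hv.const_mul _) fun w => by have := hv0 w; positivity)
      fun w => logQuadTrunc_add_log_le (hv0 w)
  linarith [psi_integral_le_add_min hh hV]

end PerturbedJensen

/-! ### Products of densities -/

section ProductMeasure

variable {ι : Type*} [Fintype ι] {α : ι → Type*} [∀ i, MeasurableSpace (α i)]
  {μ : ∀ i, Measure (α i)} [∀ i, IsProbabilityMeasure (μ i)]

theorem lintegral_pi_prod {f : ∀ i, α i → ℝ≥0∞} (hf : ∀ i, Measurable (f i)) :
    ∫⁻ x, ∏ i, f i (x i) ∂Measure.pi μ = ∏ i, ∫⁻ y, f i y ∂μ i := by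
  have hind : iIndepFun (fun i (x : ∀ i, α i) => f i (x i)) (Measure.pi μ) :=
    iIndepFun_pi fun i => (hf i).aemeasurable
  rw [lintegral_prod_eq_prod_lintegral_of_indepFun Finset.univ _ hind
    fun i => (hf i).comp (measurable_pi_apply i)]
  refine Finset.prod_congr rfl fun i _ => ?_
  exact (measurePreserving_eval μ i).lintegral_comp (hf i)

theorem pi_withDensity {f : ∀ i, α i → ℝ≥0∞} (hf : ∀ i, Measurable (f i))
    [∀ i, SigmaFinite ((μ i).withDensity (f i))] :
    Measure.pi (fun i => (μ i).withDensity (f i)) =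
      (Measure.pi μ).withDensity fun x => ∏ i, f i (x i) := by
  refine Measure.pi_eq fun s hs => ?_
  rw [withDensity_apply _ (MeasurableSet.univ_pi hs), ← lintegral_indicator (.univ_pi hs)]
  have : (Set.univ.pi s).indicator (fun x : ∀ i, α i => ∏ i, f i (x i)) =
      fun x => ∏ i, (s i).indicator (f i) (x i) := by
    ext x
    by_cases hx : x ∈ Set.univ.pi s
    · rw [Set.indicator_of_mem hx]
      exact Finset.prod_congr rfl fun i _ => (Set.indicator_of_mem (hx i (Set.mem_univ i)) _).symm
    · rw [Set.indicator_of_notMem hx]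
      simp only [Set.mem_univ_pi, not_forall] at hx
      obtain ⟨i, hi⟩ := hx
      exact (Finset.prod_eq_zero (Finset.mem_univ i) (Set.indicator_of_notMem hi _)).symm
  rw [this, lintegral_pi_prod fun i => (hf i).indicator (hs i)]
  exact Finset.prod_congr rfl fun i _ => by
    rw [lintegral_indicator (hs i), withDensity_apply _ (hs i)]

end ProductMeasure

/-! ### Gaussian translation, moments and change of measure -/

section GaussianMeasure

theorem gaussianReal_eq_withDensity (a : ℝ) :
    gaussianReal 0 1 = (gaussianReal a 1).withDensity
      fun x => ENNReal.ofReal (Real.exp (-(a * x) + a ^ 2 / 2)) := by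
  rw [gaussianReal_of_var_ne_zero _ one_ne_zero, gaussianReal_of_var_ne_zero _ one_ne_zero,
    ← withDensity_mul _ (measurable_gaussianPDF a 1) (by fun_prop)]
  congr 1
  ext x
  simp only [gaussianPDF, Pi.mul_apply]
  rw [← ENNReal.ofReal_mul (gaussianPDFReal_nonneg _ _ _)]
  congr 1
  simp only [gaussianPDFReal]
  rw [mul_assoc (√_)⁻¹, ← Real.exp_add]
  congr 2
  simp
  ring

/-- Each coordinate is reweighted from N(aᵢ, 1) to N(0, 1), and N(aᵢ, 1) is then written as a
translate. The exponent -a x + a²/2 at x = w + a becomes -a w - a²/2. -/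
theorem lintegral_gaussianPi_translate {ι : Type*} [Fintype ι] (a : ι → ℝ) {f : (ι → ℝ) → ℝ≥0∞}
    (hf : Measurable f) :
    ∫⁻ w, f w ∂Measure.pi (fun _ : ι => gaussianReal 0 1) =
      ∫⁻ w, f (fun i => w i + a i) * ENNReal.ofReal (Real.exp (-(∑ i, a i * w i) -
        (∑ i, a i ^ 2) / 2)) ∂Measure.pi (fun _ : ι => gaussianReal 0 1) := by
  have h1 : Measure.pi (fun _ : ι => gaussianReal 0 1) =
      (Measure.pi (fun i : ι => gaussianReal (a i) 1)).withDensity fun x =>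
        ∏ i, ENNReal.ofReal (Real.exp (-(a i * x i) + a i ^ 2 / 2)) := by
    have hfin : ∀ i, IsProbabilityMeasure ((gaussianReal (a i) 1).withDensity
        fun x => ENNReal.ofReal (Real.exp (-(a i * x) + a i ^ 2 / 2))) := fun i => by
      rw [← gaussianReal_eq_withDensity]; infer_instance
    rw [← pi_withDensity (μ := fun i : ι => gaussianReal (a i) 1)
      (f := fun i x => ENNReal.ofReal (Real.exp (-(a i * x) + a i ^ 2 / 2)))
      (fun i => by fun_prop)]
    congr 1
    ext1 i
    exact gaussianReal_eq_withDensity (a i)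
  have h2 : Measure.pi (fun i : ι => gaussianReal (a i) 1) =
      (Measure.pi (fun _ : ι => gaussianReal 0 1)).map fun w i => w i + a i := by
    have hm : ∀ i, (gaussianReal 0 1).map (fun x => x + a i) = gaussianReal (a i) 1 := fun i => by
      rw [gaussianReal_map_add_const, zero_add]
    have hs : ∀ i, SigmaFinite ((gaussianReal 0 1).map (fun x => x + a i)) := fun i => by
      rw [hm]; infer_instance
    rw [Measure.pi_map_pi (μ := fun _ : ι => gaussianReal 0 1) (f := fun i x => x + a i)
      fun i => by fun_prop]
    simp_rw [hm]
  conv_lhs => rw [h1]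
  rw [lintegral_withDensity_eq_lintegral_mul _ (by fun_prop) hf, h2,
    lintegral_map (by fun_prop) (by fun_prop)]
  refine lintegral_congr fun w => ?_
  simp only [Pi.mul_apply]
  rw [mul_comm, ← ENNReal.ofReal_prod_of_nonneg fun i _ => (Real.exp_pos _).le, ← Real.exp_sum]
  congr 3
  rw [← Finset.sum_neg_distrib, Finset.sum_div, ← Finset.sum_sub_distrib]
  exact Finset.sum_congr rfl fun i _ => by ring

/-- The Cameron–Martin formula for the standard Gaussian measure. -/
theorem lintegral_stdGaussian_translate {d : ℕ} (a : EuclideanSpace ℝ (Fin d))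
    {f : EuclideanSpace ℝ (Fin d) → ℝ≥0∞} (hf : Measurable f) :
    ∫⁻ w, f w ∂stdGaussian (EuclideanSpace ℝ (Fin d)) =
      ∫⁻ w, f (w + a) * ENNReal.ofReal (Real.exp (-⟪a, w⟫ - ‖a‖ ^ 2 / 2))
        ∂stdGaussian (EuclideanSpace ℝ (Fin d)) := by
  rw [← map_pi_eq_stdGaussian, lintegral_map hf (by fun_prop),
    lintegral_map (by fun_prop) (by fun_prop),
    lintegral_gaussianPi_translate (f := fun w => f (WithLp.toLp 2 w)) a.ofLp
      (hf.comp (by fun_prop))]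
  refine lintegral_congr fun w => ?_
  rw [EuclideanSpace.real_norm_sq_eq, PiLp.inner_apply]
  simp only [RCLike.inner_apply, conj_trivial]
  congr 3
  simp only [mul_comm]

theorem hasDerivAt_mul_exp_sq (v : ℝ) {p : ℝ → ℝ} {p' t : ℝ} (hp : HasDerivAt p p' t) :
    HasDerivAt (fun t => p t * Real.exp (v * t ^ 2 / 2))
      ((p' + v * t * p t) * Real.exp (v * t ^ 2 / 2)) t := by
  have h1 : HasDerivAt (fun t : ℝ => v * t ^ 2 / 2) (v * t) t := by
    have := (((hasDerivAt_id t).pow 2).const_mul v).div_const 2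
    refine this.congr_deriv ?_
    simp; ring
  refine (hp.mul h1.exp).congr_deriv ?_
  ring

/-- The fourth moment is the fourth derivative at 0 of the moment generating function exp(v t²/2).
-/
theorem integral_pow_four_gaussianReal (v : NNReal) :
    ∫ x, x ^ 4 ∂gaussianReal 0 v = 3 * (v : ℝ) ^ 2 := by
  have h0 : (0 : ℝ) ∈ interior (integrableExpSet (fun x => x) (gaussianReal 0 v)) := by simp
  have h := iteratedDeriv_mgf_zero h0 4
  have hm : mgf (fun x => x) (gaussianReal 0 v) =
      fun t => (1 : ℝ) * Real.exp (v * t ^ 2 / 2) := by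
    rw [mgf_fun_id_gaussianReal]; ext t; simp
  have d1 : deriv (fun t => (1 : ℝ) * Real.exp (v * t ^ 2 / 2)) =
      fun t => (v * t) * Real.exp (v * t ^ 2 / 2) := funext fun t => by
    rw [(hasDerivAt_mul_exp_sq v (hasDerivAt_const t 1)).deriv]; ring
  have d2 : deriv (fun t => (v * t) * Real.exp (v * t ^ 2 / 2)) =
      fun t => (v + v ^ 2 * t ^ 2) * Real.exp (v * t ^ 2 / 2) := funext fun t => by
    rw [(hasDerivAt_mul_exp_sq v ((hasDerivAt_id' t).const_mul (v : ℝ))).deriv]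
    ring
  have d3 : deriv (fun t => (v + v ^ 2 * t ^ 2) * Real.exp (v * t ^ 2 / 2)) =
      fun t => (3 * v ^ 2 * t + v ^ 3 * t ^ 3) * Real.exp (v * t ^ 2 / 2) := funext fun t => by
    rw [(hasDerivAt_mul_exp_sq v (((hasDerivAt_pow 2 t).const_mul ((v : ℝ) ^ 2)).const_add
      (v : ℝ))).deriv]
    push_cast; ring
  have d4 : deriv (fun t => (3 * v ^ 2 * t + v ^ 3 * t ^ 3) * Real.exp (v * t ^ 2 / 2))
      (0 : ℝ) = 3 * (v : ℝ) ^ 2 := by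
    have := (hasDerivAt_mul_exp_sq v (((hasDerivAt_id' (0 : ℝ)).const_mul (3 * (v : ℝ) ^ 2)).add
      ((hasDerivAt_pow 3 (0 : ℝ)).const_mul ((v : ℝ) ^ 3)))).deriv
    simpa using this
  rw [hm, iteratedDeriv_succ, iteratedDeriv_succ, iteratedDeriv_succ, iteratedDeriv_succ,
    iteratedDeriv_zero, d1, d2, d3, d4] at h
  simpa using h.symm

variable {d : ℕ}

local notation "E" => EuclideanSpace ℝ (Fin d)

theorem map_inner_stdGaussian (y : E) :
    (stdGaussian E).map (fun w => ⟪y, w⟫) = gaussianReal 0 (‖y‖₊ ^ 2) := by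
  have := IsGaussian.map_eq_gaussianReal (μ := stdGaussian E) (innerSL ℝ y)
  rw [integral_strongDual_stdGaussian, variance_dual_stdGaussian, innerSL_apply_norm] at this
  convert! this using 2
  ext; simp

theorem memLp_inner_stdGaussian (y : E) {p : ℝ≥0∞} (hp : p ≠ ∞) :
    MemLp (fun w => ⟪y, w⟫) p (stdGaussian E) := by
  have := memLp_id_gaussianReal' (μ := 0) (v := ‖y‖₊ ^ 2) p hp
  rw [← map_inner_stdGaussian] at this
  exact this.comp_of_map (by fun_prop)

theorem integrable_inner_pow_stdGaussian (y : E) (k : ℕ) :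
    Integrable (fun w => ⟪y, w⟫ ^ k) (stdGaussian E) := by
  rcases Nat.eq_zero_or_pos k with rfl | hk
  · simp
  · have := (memLp_inner_stdGaussian y (p := k) (by simp)).integrable_norm_pow hk.ne'
    exact (integrable_norm_iff (by fun_prop)).1 (by simpa using this)

theorem integral_comp_inner_stdGaussian (y : E) {f : ℝ → ℝ} (hf : Continuous f) :
    ∫ w, f ⟪y, w⟫ ∂stdGaussian E = ∫ x, f x ∂gaussianReal 0 (‖y‖₊ ^ 2) := by
  rw [← map_inner_stdGaussian, integral_map (by fun_prop) hf.aestronglyMeasurable]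

theorem integral_inner_stdGaussian (y : E) : ∫ w, ⟪y, w⟫ ∂stdGaussian E = 0 := by
  rw [integral_comp_inner_stdGaussian y (f := fun x => x) continuous_id]; simp

theorem integral_inner_sq_stdGaussian (y : E) : ∫ w, ⟪y, w⟫ ^ 2 ∂stdGaussian E = ‖y‖ ^ 2 := by
  rw [integral_comp_inner_stdGaussian y (f := fun x => x ^ 2) (by fun_prop)]
  have := variance_fun_id_gaussianReal (μ := 0) (v := ‖y‖₊ ^ 2)
  rw [variance_eq_sub (by exact memLp_id_gaussianReal' 2 (by simp))] at this
  simpa using this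

theorem integral_inner_pow_four_stdGaussian (y : E) :
    ∫ w, ⟪y, w⟫ ^ 4 ∂stdGaussian E = 3 * ‖y‖ ^ 4 := by
  rw [integral_comp_inner_stdGaussian y (f := fun x => x ^ 4) (by fun_prop),
    integral_pow_four_gaussianReal]
  simp; ring

theorem measurePreserving_neg_stdGaussian :
    MeasurePreserving (fun w : E => -w) (stdGaussian E) (stdGaussian E) :=
  ⟨measurable_neg, stdGaussian_map (LinearIsometryEquiv.neg ℝ : E ≃ₗᵢ[ℝ] E)⟩

theorem integral_inner_pow_three_stdGaussian (y : E) :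
    ∫ w, ⟪y, w⟫ ^ 3 ∂stdGaussian E = 0 := by
  have h := measurePreserving_neg_stdGaussian.integral_comp' (f := MeasurableEquiv.neg E)
    (fun w : E => ⟪y, w⟫ ^ 3)
  simp only [MeasurableEquiv.neg_apply, inner_neg_right] at h
  have : ∀ x : ℝ, (-x) ^ 3 = -x ^ 3 := fun x => by ring
  simp only [this, integral_neg] at h
  linarith

/-- A Gaussian change of measure inequality: the entropy of the translated Gaussian with respect to
the centred one is `‖η‖² / (2 τ²)`. -/
theorem integral_translate_le_log_add {F : E → ℝ} (hF : Measurable F) {τ : ℝ} (hτ : τ ≠ 0) {M : ℝ}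
    (hM : 0 < M)
    (hexp : ∫⁻ w, ENNReal.ofReal (Real.exp (F (τ • w))) ∂stdGaussian E ≤ ENNReal.ofReal M)
    (η : E) (hint : Integrable (fun w => F (η + τ • w)) (stdGaussian E)) :
    ∫ w, F (η + τ • w) ∂stdGaussian E ≤ Real.log M + ‖η‖ ^ 2 / (2 * τ ^ 2) := by
  -- Translating the standard Gaussian by η/τ carries τ w to η + τ w.
  set a : E := τ⁻¹ • η with ha
  have hshift : ∀ w : E, τ • (w + a) = η + τ • w := fun w => by
    rw [smul_add, ha, smul_smul, mul_inv_cancel₀ hτ, one_smul, add_comm]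
  have hna : ‖a‖ ^ 2 / 2 = ‖η‖ ^ 2 / (2 * τ ^ 2) := by
    rw [ha, norm_smul, norm_inv, Real.norm_eq_abs, mul_pow, inv_pow, sq_abs]
    field_simp
  set g : E → ℝ := fun w => F (η + τ • w) - ⟪a, w⟫ - ‖a‖ ^ 2 / 2 with hg
  have hgi : Integrable g (stdGaussian E) :=
    (hint.sub (by simpa using integrable_inner_pow_stdGaussian a 1)).sub (integrable_const _)
  have hgm : Measurable g := by
    have : Measurable fun w : E => F (η + τ • w) := hF.comp (by fun_prop)
    fun_prop
  have hlin : ∫⁻ w, ENNReal.ofReal (Real.exp (g w)) ∂stdGaussian E ≤ ENNReal.ofReal M := by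
    rw [lintegral_stdGaussian_translate a (by fun_prop)] at hexp
    convert hexp using 3 with w
    rw [← ENNReal.ofReal_mul (Real.exp_pos _).le, ← Real.exp_add, hshift, hg]
    congr 2
    ring
  have hei : Integrable (fun w => Real.exp (g w)) (stdGaussian E) :=
    ⟨(by fun_prop : Measurable fun w => Real.exp (g w)).aestronglyMeasurable, by
      rw [hasFiniteIntegral_iff_ofReal (Filter.Eventually.of_forall fun w => (Real.exp_pos _).le)]
      exact hlin.trans_lt ENNReal.ofReal_lt_top⟩
  have hle : ∫ w, Real.exp (g w) ∂stdGaussian E ≤ M := by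
    rw [integral_eq_lintegral_of_nonneg_ae (Filter.Eventually.of_forall fun w => (Real.exp_pos _).le)
      hei.aestronglyMeasurable]
    exact ENNReal.toReal_le_of_le_ofReal hM.le hlin
  -- Jensen's inequality for exp bounds the mean of the reweighted exponent by the logarithm of the
  -- exponential moment.
  have hj : Real.exp (∫ w, g w ∂stdGaussian E) ≤ ∫ w, Real.exp (g w) ∂stdGaussian E :=
    convexOn_exp.map_integral_le Real.continuous_exp.continuousOn isClosed_univ
      (Filter.Eventually.of_forall fun _ => Set.mem_univ _) hgi hei
  have hlog : ∫ w, g w ∂stdGaussian E ≤ Real.log M := by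
    rw [Real.le_log_iff_exp_le hM]; exact hj.trans hle
  have hgint : ∫ w, g w ∂stdGaussian E =
      ∫ w, F (η + τ • w) ∂stdGaussian E - ‖a‖ ^ 2 / 2 := by
    have hi : Integrable (fun w : E => ⟪a, w⟫) (stdGaussian E) := by
      simpa using integrable_inner_pow_stdGaussian a 1
    have hi' : Integrable (fun w : E => F (η + τ • w) - ⟪a, w⟫) (stdGaussian E) := hint.sub hi
    rw [hg, integral_sub hi' (integrable_const _), integral_sub hint hi,
      integral_inner_stdGaussian]
    simp
  rw [← hna]
  linarith

end GaussianMeasure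

/-! ### The PAC-Bayesian bound for the perturbed quadratic loss -/

section PacBayes

variable {d : ℕ}

local notation "E" => EuclideanSpace ℝ (Fin d)

theorem integrable_poly_inner_stdGaussian (y : E) (p₀ p₁ p₂ p₃ p₄ : ℝ) :
    Integrable (fun w => p₀ + p₁ * ⟪y, w⟫ + p₂ * ⟪y, w⟫ ^ 2 + p₃ * ⟪y, w⟫ ^ 3 + p₄ * ⟪y, w⟫ ^ 4)
      (stdGaussian E) := by
  have h1 : Integrable (fun w => ⟪y, w⟫) (stdGaussian E) := by
    simpa using integrable_inner_pow_stdGaussian y 1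
  exact ((((integrable_const p₀).add (h1.const_mul p₁)).add
    ((integrable_inner_pow_stdGaussian y 2).const_mul p₂)).add
    ((integrable_inner_pow_stdGaussian y 3).const_mul p₃)).add
    ((integrable_inner_pow_stdGaussian y 4).const_mul p₄)

theorem integral_poly_inner_stdGaussian (y : E) (p₀ p₁ p₂ p₃ p₄ : ℝ) :
    ∫ w, (p₀ + p₁ * ⟪y, w⟫ + p₂ * ⟪y, w⟫ ^ 2 + p₃ * ⟪y, w⟫ ^ 3 + p₄ * ⟪y, w⟫ ^ 4)
      ∂stdGaussian E = p₀ + p₂ * ‖y‖ ^ 2 + 3 * p₄ * ‖y‖ ^ 4 := by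
  have h4 := (integrable_inner_pow_stdGaussian y 4).const_mul p₄
  have h3 := (integrable_inner_pow_stdGaussian y 3).const_mul p₃
  have h2 := (integrable_inner_pow_stdGaussian y 2).const_mul p₂
  have i3 := integrable_poly_inner_stdGaussian y p₀ p₁ p₂ p₃ 0
  have i2 := integrable_poly_inner_stdGaussian y p₀ p₁ p₂ 0 0
  have i1 := integrable_poly_inner_stdGaussian y p₀ p₁ 0 0 0
  have h1 := integrable_poly_inner_stdGaussian y 0 p₁ 0 0 0
  simp only [zero_mul, add_zero, zero_add] at i1 i2 i3 h1
  rw [integral_add i3 h4, integral_add i2 h3, integral_add i1 h2,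
    integral_add (integrable_const _) h1, integral_const_mul, integral_const_mul,
    integral_const_mul, integral_const_mul, integral_inner_stdGaussian,
    integral_inner_sq_stdGaussian, integral_inner_pow_three_stdGaussian,
    integral_inner_pow_four_stdGaussian]
  simp
  ring

/-- The centred perturbed loss `c (⟨u, y⟩² - τ² ‖y‖² - 1)`. -/
noncomputable def perturbedLoss (c τ : ℝ) (y u : E) : ℝ :=
  c * (⟪u, y⟫ ^ 2 - τ ^ 2 * ‖y‖ ^ 2 - 1)

/-- A proxy for the variance of the perturbed loss. -/
noncomputable def perturbedVar (c τ : ℝ) (y u : E) : ℝ :=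
  c ^ 2 * (4 * ⟪u, y⟫ ^ 2 * (τ ^ 2 * ‖y‖ ^ 2) + 2 * (τ ^ 2 * ‖y‖ ^ 2) ^ 2)

/-- The quantity whose logarithm dominates the influence function. -/
noncomputable def perturbedQuad (c τ : ℝ) (y u : E) : ℝ :=
  1 + perturbedLoss c τ y u + perturbedLoss c τ y u ^ 2 / 2 + 15 / 2 * perturbedVar c τ y u

/-- The Gaussian average of `perturbedQuad - 1`, as a function of `a = ⟨η, y⟩` and `r = ‖y‖`. -/
noncomputable def meanExcess (c τ a r : ℝ) : ℝ :=
  c * (a ^ 2 - 1) + c ^ 2 / 2 * (a ^ 2 - 1) ^ 2 + 32 * c ^ 2 * τ ^ 2 * (a ^ 2 * r ^ 2) +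
    46 * c ^ 2 * τ ^ 4 * r ^ 4

theorem perturbedVar_nonneg (c τ : ℝ) (y u : E) : 0 ≤ perturbedVar c τ y u := by
  unfold perturbedVar; positivity

theorem half_le_perturbedQuad (c τ : ℝ) (y u : E) : 1 / 2 ≤ perturbedQuad c τ y u := by
  have := half_le_quad (perturbedLoss c τ y u)
  have := perturbedVar_nonneg c τ y u
  unfold perturbedQuad
  linarith

theorem perturbedQuad_pos (c τ : ℝ) (y u : E) : 0 < perturbedQuad c τ y u := by
  linarith [half_le_perturbedQuad c τ y u]

theorem inner_add_smul_eq (τ : ℝ) (y η w : E) : ⟪η + τ • w, y⟫ = ⟪η, y⟫ + τ * ⟪y, w⟫ := by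
  rw [inner_add_left, real_inner_smul_left, real_inner_comm w y]

theorem perturbedLoss_translate (c τ : ℝ) (y η w : E) :
    perturbedLoss c τ y (η + τ • w) = c * (⟪η, y⟫ ^ 2 - τ ^ 2 * ‖y‖ ^ 2 - 1) +
      2 * c * τ * ⟪η, y⟫ * ⟪y, w⟫ + c * τ ^ 2 * ⟪y, w⟫ ^ 2 + 0 * ⟪y, w⟫ ^ 3 +
      0 * ⟪y, w⟫ ^ 4 := by
  unfold perturbedLoss
  rw [inner_add_smul_eq]
  ring

/-- The term τ²‖y‖² in the loss compensates the variance of the noise ⟨τ w, y⟩, so the perturbation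
is unbiased. -/
theorem integral_perturbedLoss (c τ : ℝ) (y η : E) :
    ∫ w, perturbedLoss c τ y (η + τ • w) ∂stdGaussian E = c * (⟪η, y⟫ ^ 2 - 1) := by
  simp_rw [perturbedLoss_translate]
  rw [integral_poly_inner_stdGaussian]
  ring

theorem integral_perturbedLoss_sub_sq (c τ : ℝ) (y η : E) :
    ∫ w, (perturbedLoss c τ y (η + τ • w) - c * (⟪η, y⟫ ^ 2 - 1)) ^ 2 ∂stdGaussian E =
      c ^ 2 * (4 * ⟪η, y⟫ ^ 2 * (τ ^ 2 * ‖y‖ ^ 2) + 2 * (τ ^ 2 * ‖y‖ ^ 2) ^ 2) := by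
  have : ∀ w : E, (perturbedLoss c τ y (η + τ • w) - c * (⟪η, y⟫ ^ 2 - 1)) ^ 2 =
      (c * τ ^ 2 * ‖y‖ ^ 2) ^ 2 + (-4 * c ^ 2 * τ ^ 3 * ⟪η, y⟫ * ‖y‖ ^ 2) * ⟪y, w⟫ +
        (4 * c ^ 2 * τ ^ 2 * ⟪η, y⟫ ^ 2 - 2 * c ^ 2 * τ ^ 4 * ‖y‖ ^ 2) * ⟪y, w⟫ ^ 2 +
        (4 * c ^ 2 * τ ^ 3 * ⟪η, y⟫) * ⟪y, w⟫ ^ 3 + (c ^ 2 * τ ^ 4) * ⟪y, w⟫ ^ 4 := fun w => by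
    rw [perturbedLoss_translate]; ring
  simp_rw [this]
  rw [integral_poly_inner_stdGaussian]
  ring

theorem perturbedVar_translate (c τ : ℝ) (y η w : E) :
    perturbedVar c τ y (η + τ • w) =
      c ^ 2 * (4 * ⟪η, y⟫ ^ 2 * (τ ^ 2 * ‖y‖ ^ 2) + 2 * (τ ^ 2 * ‖y‖ ^ 2) ^ 2) +
      8 * c ^ 2 * τ ^ 3 * ‖y‖ ^ 2 * ⟪η, y⟫ * ⟪y, w⟫ +
      4 * c ^ 2 * τ ^ 4 * ‖y‖ ^ 2 * ⟪y, w⟫ ^ 2 + 0 * ⟪y, w⟫ ^ 3 + 0 * ⟪y, w⟫ ^ 4 := by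
  unfold perturbedVar
  rw [inner_add_smul_eq]
  ring

theorem integrable_perturbedVar (c τ : ℝ) (y η : E) :
    Integrable (fun w => perturbedVar c τ y (η + τ • w)) (stdGaussian E) := by
  simp_rw [perturbedVar_translate]
  exact integrable_poly_inner_stdGaussian _ _ _ _ _ _

theorem measurable_perturbedLoss (c τ : ℝ) :
    Measurable fun p : E × E => perturbedLoss c τ p.1 p.2 := by
  unfold perturbedLoss; fun_prop

theorem measurable_perturbedVar (c τ : ℝ) :
    Measurable fun p : E × E => perturbedVar c τ p.1 p.2 := by
  unfold perturbedVar; fun_prop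

theorem measurable_perturbedQuad (c τ : ℝ) :
    Measurable fun p : E × E => perturbedQuad c τ p.1 p.2 := by
  have h1 := measurable_perturbedLoss (d := d) c τ
  have h2 := measurable_perturbedVar (d := d) c τ
  unfold perturbedQuad
  fun_prop

theorem memLp_two_perturbedLoss (c τ : ℝ) (y η : E) :
    MemLp (fun w => perturbedLoss c τ y (η + τ • w)) 2 (stdGaussian E) := by
  have hm : Measurable fun w : E => perturbedLoss c τ y (η + τ • w) :=
    (measurable_perturbedLoss c τ).comp (f := fun w => (y, η + τ • w)) (by fun_prop)
  rw [memLp_two_iff_integrable_sq hm.aestronglyMeasurable]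
  have : ∀ w : E, perturbedLoss c τ y (η + τ • w) ^ 2 =
      (c * (⟪η, y⟫ ^ 2 - τ ^ 2 * ‖y‖ ^ 2 - 1)) ^ 2 +
      (4 * c ^ 2 * τ * ⟪η, y⟫ * (⟪η, y⟫ ^ 2 - τ ^ 2 * ‖y‖ ^ 2 - 1)) * ⟪y, w⟫ +
      (4 * c ^ 2 * τ ^ 2 * ⟪η, y⟫ ^ 2 +
        2 * c ^ 2 * τ ^ 2 * (⟪η, y⟫ ^ 2 - τ ^ 2 * ‖y‖ ^ 2 - 1)) * ⟪y, w⟫ ^ 2 +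
      (4 * c ^ 2 * τ ^ 3 * ⟪η, y⟫) * ⟪y, w⟫ ^ 3 + (c ^ 2 * τ ^ 4) * ⟪y, w⟫ ^ 4 := fun w => by
    rw [perturbedLoss_translate]; ring
  simp_rw [this]
  exact integrable_poly_inner_stdGaussian _ _ _ _ _ _

theorem psi_le_integral_log_perturbedQuad (c τ : ℝ) (y η : E) :
    psi (c * (⟪η, y⟫ ^ 2 - 1)) ≤
      ∫ w, Real.log (perturbedQuad c τ y (η + τ • w)) ∂stdGaussian E := by
  rw [← integral_perturbedLoss c τ y η]
  refine psi_integral_le (memLp_two_perturbedLoss c τ y η) (integrable_perturbedVar c τ y η)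
    (fun w => perturbedVar_nonneg c τ y _) measurePreserving_neg_stdGaussian
    (V := c ^ 2 * (4 * ⟪η, y⟫ ^ 2 * (τ ^ 2 * ‖y‖ ^ 2) + 2 * (τ ^ 2 * ‖y‖ ^ 2) ^ 2)) ?_ fun w => ?_
  · rw [integral_perturbedLoss, integral_perturbedLoss_sub_sq]
  -- The proxy has ⟨u, y⟩² where the variance has ⟨η, y⟩², since it may depend on the perturbed
  -- parameter only. Adding the values at w and -w cancels the odd term and leaves a nonnegative
  -- surplus.
  · rw [perturbedVar_translate, perturbedVar_translate, inner_neg_right]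
    have : 0 ≤ c ^ 2 * τ ^ 4 * ‖y‖ ^ 2 * ⟪y, w⟫ ^ 2 := by positivity
    nlinarith

theorem integrable_log_perturbedQuad (c τ : ℝ) (y η : E) :
    Integrable (fun w => Real.log (perturbedQuad c τ y (η + τ • w))) (stdGaussian E) :=
  integrable_log_quad_add (memLp_two_perturbedLoss c τ y η)
    ((integrable_perturbedVar c τ y η).const_mul _) fun w =>
      mul_nonneg (by norm_num) (perturbedVar_nonneg c τ y _)

theorem integrable_perturbedQuad (c τ : ℝ) (y η : E) :
    Integrable (fun w => perturbedQuad c τ y (η + τ • w)) (stdGaussian E) :=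
  (((integrable_const 1).add ((memLp_two_perturbedLoss c τ y η).integrable one_le_two)).add
    ((memLp_two_perturbedLoss c τ y η).integrable_sq.div_const 2)).add
    ((integrable_perturbedVar c τ y η).const_mul _)

/-- With s = τ²r², half the variance c²(4a²s + 2s²) plus 15/2 times the mean c²(4a²s + 6s²) of the
proxy produces the constants 32 and 46. -/
theorem integral_perturbedQuad (c τ : ℝ) (y η : E) :
    ∫ w, perturbedQuad c τ y (η + τ • w) ∂stdGaussian E = 1 + meanExcess c τ ⟪η, y⟫ ‖y‖ := by
  have : ∀ w : E, perturbedQuad c τ y (η + τ • w) =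
      (1 + c * (⟪η, y⟫ ^ 2 - τ ^ 2 * ‖y‖ ^ 2 - 1) +
        (c * (⟪η, y⟫ ^ 2 - τ ^ 2 * ‖y‖ ^ 2 - 1)) ^ 2 / 2 +
        15 / 2 * (c ^ 2 * (4 * ⟪η, y⟫ ^ 2 * (τ ^ 2 * ‖y‖ ^ 2) + 2 * (τ ^ 2 * ‖y‖ ^ 2) ^ 2))) +
      (2 * c * τ * ⟪η, y⟫ +
        2 * c ^ 2 * τ * ⟪η, y⟫ * (⟪η, y⟫ ^ 2 - τ ^ 2 * ‖y‖ ^ 2 - 1) +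
        60 * c ^ 2 * τ ^ 3 * ‖y‖ ^ 2 * ⟪η, y⟫) * ⟪y, w⟫ +
      (c * τ ^ 2 + 2 * c ^ 2 * τ ^ 2 * ⟪η, y⟫ ^ 2 +
        c ^ 2 * τ ^ 2 * (⟪η, y⟫ ^ 2 - τ ^ 2 * ‖y‖ ^ 2 - 1) +
        30 * c ^ 2 * τ ^ 4 * ‖y‖ ^ 2) * ⟪y, w⟫ ^ 2 +
      (2 * c ^ 2 * τ ^ 3 * ⟪η, y⟫) * ⟪y, w⟫ ^ 3 + (c ^ 2 * τ ^ 4 / 2) * ⟪y, w⟫ ^ 4 := fun w => by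
    unfold perturbedQuad
    rw [perturbedLoss_translate, perturbedVar_translate]; ring
  simp_rw [this]
  rw [integral_poly_inner_stdGaussian]
  unfold meanExcess
  ring

variable {Q : Measure (EuclideanSpace ℝ (Fin d))} [IsProbabilityMeasure Q]

theorem integrable_norm_pow_of_memLp_four (hQ : MemLp id 4 Q) {k : ℕ} (hk : k ≤ 4) :
    Integrable (fun y => ‖y‖ ^ k) Q := by
  rcases Nat.eq_zero_or_pos k with rfl | hk0
  · simp
  · have : MemLp id (k : ℝ≥0∞) Q := hQ.mono_exponent (by exact_mod_cast hk)
    exact this.integrable_norm_pow hk0.ne'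

theorem integrable_inner_pow_mul_norm_pow (hQ : MemLp id 4 Q) (u : E) {j k : ℕ} (hjk : j + k ≤ 4) :
    Integrable (fun y => ⟪u, y⟫ ^ j * ‖y‖ ^ k) Q := by
  refine ((integrable_norm_pow_of_memLp_four hQ hjk).const_mul (‖u‖ ^ j)).mono'
    (by fun_prop) (Filter.Eventually.of_forall fun y => ?_)
  rw [norm_mul, norm_pow, norm_pow, norm_norm, pow_add, ← mul_assoc, ← mul_pow]
  gcongr
  exact norm_inner_le_norm u y

theorem integrable_meanExcess (hQ : MemLp id 4 Q) (c τ : ℝ) (η : E) :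
    Integrable (fun y => meanExcess c τ ⟪η, y⟫ ‖y‖) Q := by
  have h40 := integrable_inner_pow_mul_norm_pow hQ η (j := 4) (k := 0) le_rfl
  have h20 := integrable_inner_pow_mul_norm_pow hQ η (j := 2) (k := 0) (by norm_num)
  have h22 := integrable_inner_pow_mul_norm_pow hQ η (j := 2) (k := 2) le_rfl
  have h04 := integrable_norm_pow_of_memLp_four hQ le_rfl
  refine (((((integrable_const (-c + c ^ 2 / 2)).add (h20.const_mul (c - c ^ 2))).add
    (h40.const_mul (c ^ 2 / 2))).add (h22.const_mul (32 * c ^ 2 * τ ^ 2))).add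
    (h04.const_mul (46 * c ^ 2 * τ ^ 4))).congr (Filter.Eventually.of_forall fun y => ?_)
  simp only [Pi.add_apply, meanExcess]
  ring

theorem integrable_perturbedQuad_left (hQ : MemLp id 4 Q) (c τ : ℝ) (u : E) :
    Integrable (fun y => perturbedQuad c τ y u) Q := by
  have h40 := integrable_inner_pow_mul_norm_pow hQ u (j := 4) (k := 0) le_rfl
  have h20 := integrable_inner_pow_mul_norm_pow hQ u (j := 2) (k := 0) (by norm_num)
  have h22 := integrable_inner_pow_mul_norm_pow hQ u (j := 2) (k := 2) le_rfl
  have h02 := integrable_norm_pow_of_memLp_four hQ (k := 2) (by norm_num)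
  have h04 := integrable_norm_pow_of_memLp_four hQ le_rfl
  refine ((((((integrable_const (1 - c + c ^ 2 / 2)).add (h20.const_mul (c - c ^ 2))).add
    (h40.const_mul (c ^ 2 / 2))).add (h22.const_mul (29 * c ^ 2 * τ ^ 2))).add
    (h04.const_mul (31 / 2 * c ^ 2 * τ ^ 4))).add
    (h02.const_mul (c ^ 2 * τ ^ 2 - c * τ ^ 2))).congr (Filter.Eventually.of_forall fun y => ?_)
  simp only [Pi.add_apply, perturbedQuad, perturbedLoss, perturbedVar]
  ring

theorem integrable_perturbedQuad_prod (hQ : MemLp id 4 Q) (c τ : ℝ) (η : E) :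
    Integrable (fun p : E × E => perturbedQuad c τ p.2 (η + τ • p.1)) ((stdGaussian E).prod Q) := by
  have hm : Measurable (fun p : E × E => perturbedQuad c τ p.2 (η + τ • p.1)) :=
    (measurable_perturbedQuad c τ).comp (g := fun p : E × E => perturbedQuad c τ p.1 p.2)
      (f := fun p : E × E => (p.2, η + τ • p.1)) (by fun_prop)
  rw [integrable_prod_iff' hm.aestronglyMeasurable]
  refine ⟨Filter.Eventually.of_forall fun y => integrable_perturbedQuad c τ y η, ?_⟩
  simp_rw [Real.norm_eq_abs, abs_of_pos (perturbedQuad_pos c τ _ _), integral_perturbedQuad]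
  exact (integrable_const 1).add (integrable_meanExcess hQ c τ η)

/-- A PAC-Bayesian bound for the empirical mean of the influence function, uniform in the
parameter. -/
theorem exists_measurableSet_sum_psi_le (hQ : MemLp id 4 Q) (n : ℕ) (c : ℝ) {τ : ℝ} (hτ : τ ≠ 0)
    {ε : ℝ} (hε : 0 < ε) :
    ∃ A : Set (Fin n → E), MeasurableSet A ∧
      Measure.pi (fun _ : Fin n => Q) Aᶜ ≤ ENNReal.ofReal ε ∧
      ∀ y ∈ A, ∀ η : E, ∑ i, psi (c * (⟪η, y i⟫ ^ 2 - 1)) ≤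
        n * ∫ z, meanExcess c τ ⟪η, z⟫ ‖z‖ ∂Q + Real.log ε⁻¹ + ‖η‖ ^ 2 / (2 * τ ^ 2) := by
  set D : E → ℝ := fun u => ∫ z, (perturbedQuad c τ z u - 1) ∂Q with hD
  have hDm : Measurable D := by
    have : StronglyMeasurable (fun p : E × E => perturbedQuad c τ p.2 p.1 - 1) :=
      ((measurable_perturbedQuad c τ).comp (g := fun p : E × E => perturbedQuad c τ p.1 p.2)
        measurable_swap).sub_const 1 |>.stronglyMeasurable
    exact this.integral_prod_right.measurable
  have hD1 : ∀ u, ∫ z, perturbedQuad c τ z u ∂Q = 1 + D u := fun u => by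
    rw [hD]
    simp only
    rw [integral_sub (integrable_perturbedQuad_left hQ c τ u) (integrable_const _)]
    simp
  set F : (Fin n → E) → E → ℝ := fun y u =>
    ∑ i, (Real.log (perturbedQuad c τ (y i) u) - D u) with hF
  have hFm : Measurable fun p : (Fin n → E) × E => F p.1 p.2 := by
    refine Finset.measurable_sum _ fun i _ => Measurable.sub ?_ (hDm.comp measurable_snd)
    exact Real.measurable_log.comp ((measurable_perturbedQuad c τ).comp
      (g := fun p : E × E => perturbedQuad c τ p.1 p.2)
      (f := fun p : (Fin n → E) × E => (p.1 i, p.2)) (by fun_prop))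
  clear_value F
  -- For fixed u, independence factorises the expectation, and each factor is (1 + D u)e^{-D u} ≤ 1.
  have hle1 : ∀ u, ∫⁻ y, ENNReal.ofReal (Real.exp (F y u)) ∂Measure.pi (fun _ : Fin n => Q) ≤ 1 := by
    intro u
    have h1 : ∀ y : Fin n → E, ENNReal.ofReal (Real.exp (F y u)) =
        ∏ i, ENNReal.ofReal (perturbedQuad c τ (y i) u * Real.exp (-D u)) := fun y => by
      rw [hF]
      simp only
      rw [Real.exp_sum, ENNReal.ofReal_prod_of_nonneg fun i _ => (Real.exp_pos _).le]
      refine Finset.prod_congr rfl fun i _ => ?_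
      rw [sub_eq_add_neg, Real.exp_add, Real.exp_log (perturbedQuad_pos c τ _ _)]
    have hmu : Measurable fun z => perturbedQuad c τ z u :=
      (measurable_perturbedQuad c τ).comp (g := fun p : E × E => perturbedQuad c τ p.1 p.2)
        (f := fun z : E => (z, u)) (by fun_prop)
    simp_rw [h1]
    rw [lintegral_pi_prod (μ := fun _ : Fin n => Q)
      (f := fun _ z => ENNReal.ofReal (perturbedQuad c τ z u * Real.exp (-D u)))
      fun i => by fun_prop]
    refine Finset.prod_le_one (fun _ _ => zero_le) fun i _ => ?_
    rw [← ofReal_integral_eq_lintegral_ofReal ((integrable_perturbedQuad_left hQ c τ u).mul_const _)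
      (Filter.Eventually.of_forall fun z =>
        mul_nonneg (perturbedQuad_pos c τ z u).le (Real.exp_pos _).le), integral_mul_const, hD1]
    rw [ENNReal.ofReal_le_one, Real.exp_neg, ← div_eq_mul_inv, div_le_one (Real.exp_pos _),
      add_comm]
    exact Real.add_one_le_exp _
  set G : (Fin n → E) → ℝ≥0∞ := fun y =>
    ∫⁻ w, ENNReal.ofReal (Real.exp (F y (τ • w))) ∂stdGaussian E with hG
  have hjoint : Measurable fun p : (Fin n → E) × E =>
      ENNReal.ofReal (Real.exp (F p.1 (τ • p.2))) := by
    have : Measurable fun p : (Fin n → E) × E => F p.1 (τ • p.2) :=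
      hFm.comp (f := fun p : (Fin n → E) × E => (p.1, τ • p.2)) (by fun_prop)
    fun_prop
  have hGm : Measurable G := hjoint.lintegral_prod_right'
  have hGint : ∫⁻ y, G y ∂Measure.pi (fun _ : Fin n => Q) ≤ 1 := by
    rw [hG, lintegral_lintegral_swap hjoint.aemeasurable]
    calc ∫⁻ w, ∫⁻ y, ENNReal.ofReal (Real.exp (F y (τ • w))) ∂Measure.pi (fun _ : Fin n => Q)
          ∂stdGaussian E ≤ ∫⁻ _w, 1 ∂stdGaussian E := lintegral_mono fun w => hle1 _
      _ = 1 := by simp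
  -- The event involves only the centred noise; Markov's inequality is used once, and η enters later
  -- through the change of measure.
  refine ⟨{y | G y ≤ ENNReal.ofReal ε⁻¹}, measurableSet_le hGm measurable_const, ?_, ?_⟩
  · have hmk := mul_meas_ge_le_lintegral (μ := Measure.pi (fun _ : Fin n => Q)) hGm
      (ENNReal.ofReal ε⁻¹)
    have hsub : {y | G y ≤ ENNReal.ofReal ε⁻¹}ᶜ ⊆ {y | ENNReal.ofReal ε⁻¹ ≤ G y} := fun y hy => by
      rw [Set.mem_compl_iff, Set.mem_ofPred_eq, not_le] at hy
      exact hy.le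
    refine (measure_mono hsub).trans ?_
    have h0 : ENNReal.ofReal ε⁻¹ ≠ 0 := by simpa using hε
    rw [ENNReal.ofReal_inv_of_pos hε] at hmk h0 ⊢
    have h2 := hmk.trans hGint
    rw [← ENNReal.div_eq_inv_mul, ENNReal.div_le_iff (by simpa using hε) (by simp), one_mul] at h2
    exact h2
  · intro y hy η
    have hlogi : ∀ i, Integrable (fun w => Real.log (perturbedQuad c τ (y i) (η + τ • w)))
        (stdGaussian E) := fun i => integrable_log_perturbedQuad c τ (y i) η
    have hprod := integrable_perturbedQuad_prod hQ c τ η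
    have hDeq : ∀ w, D (η + τ • w) = ∫ z, perturbedQuad c τ z (η + τ • w) ∂Q - 1 := fun w => by
      rw [hD1]; ring
    have hDi : Integrable (fun w => D (η + τ • w)) (stdGaussian E) := by
      simp_rw [hDeq]
      exact hprod.integral_prod_left.sub (integrable_const 1)
    have hDint : ∫ w, D (η + τ • w) ∂stdGaussian E = ∫ z, meanExcess c τ ⟪η, z⟫ ‖z‖ ∂Q := by
      simp_rw [hDeq]
      rw [integral_sub hprod.integral_prod_left (integrable_const 1),
        integral_integral_swap hprod]
      simp_rw [integral_perturbedQuad]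
      rw [integral_add (integrable_const _) (integrable_meanExcess hQ c τ η)]
      simp
    have hsubi : ∀ i, Integrable (fun w => Real.log (perturbedQuad c τ (y i) (η + τ • w)) -
        D (η + τ • w)) (stdGaussian E) := fun i => (hlogi i).sub hDi
    have hFi : Integrable (fun w => F y (η + τ • w)) (stdGaussian E) := by
      rw [hF]
      exact integrable_finsetSum _ fun i _ => hsubi i
    have hFym : Measurable (F y) := hFm.comp (f := fun u => (y, u)) (by fun_prop)
    rw [Set.mem_ofPred_eq, hG] at hy
    have hpac := integral_translate_le_log_add (F := F y) (M := ε⁻¹) hFym hτ (inv_pos.2 hε) hy η hFi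
    have hFint : ∫ w, F y (η + τ • w) ∂stdGaussian E =
        ∑ i, ∫ w, Real.log (perturbedQuad c τ (y i) (η + τ • w)) ∂stdGaussian E -
          n * ∫ z, meanExcess c τ ⟪η, z⟫ ‖z‖ ∂Q := by
      rw [hF]
      simp only
      rw [integral_finsetSum _ fun i _ => hsubi i]
      simp_rw [integral_sub (hlogi _) hDi, hDint]
      rw [Finset.sum_sub_distrib]
      simp
    have hsum : ∑ i, psi (c * (⟪η, y i⟫ ^ 2 - 1)) ≤
        ∑ i, ∫ w, Real.log (perturbedQuad c τ (y i) (η + τ • w)) ∂stdGaussian E :=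
      Finset.sum_le_sum fun i _ => psi_le_integral_log_perturbedQuad c τ (y i) η
    linarith

/-- The mixed moment is at most κdt by the weighted inequality ab ≤ (a²/t + t b²)/2 on each
coordinate, and E‖z‖⁴ ≤ κd² by Cauchy–Schwarz. -/
theorem integral_meanExcess_le (hQ : MemLp id 4 Q) {κ : ℝ}
    (hcoord : ∀ j : Fin d, ∫ z, z j ^ 4 ∂Q ≤ κ) {t : ℝ} (ht : 0 < t) {η : E}
    (h2 : ∫ z, ⟪η, z⟫ ^ 2 ∂Q = t) (h4 : ∫ z, ⟪η, z⟫ ^ 4 ∂Q ≤ κ * t ^ 2) (c τ : ℝ) :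
    ∫ z, meanExcess c τ ⟪η, z⟫ ‖z‖ ∂Q ≤
      c * (t - 1) + c ^ 2 / 2 * (κ * t ^ 2 - 2 * t + 1) + 32 * c ^ 2 * τ ^ 2 * (κ * d * t) +
        46 * c ^ 2 * τ ^ 4 * (κ * d ^ 2) := by
  have h40 : Integrable (fun z => ⟪η, z⟫ ^ 4) Q := by
    simpa using integrable_inner_pow_mul_norm_pow hQ η (j := 4) (k := 0) le_rfl
  have h20 : Integrable (fun z => ⟪η, z⟫ ^ 2) Q := by
    simpa using integrable_inner_pow_mul_norm_pow hQ η (j := 2) (k := 0) (by norm_num)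
  have h22 := integrable_inner_pow_mul_norm_pow hQ η (j := 2) (k := 2) le_rfl
  have h04 := integrable_norm_pow_of_memLp_four hQ le_rfl
  have hc4 : ∀ j : Fin d, Integrable (fun z : E => z j ^ 4) Q := fun j => by
    have := integrable_inner_pow_mul_norm_pow hQ (EuclideanSpace.single j 1) (j := 4) (k := 0) le_rfl
    simpa [EuclideanSpace.inner_single_left] using this
  have hmean : ∫ z, meanExcess c τ ⟪η, z⟫ ‖z‖ ∂Q =
      (-c + c ^ 2 / 2) + (c - c ^ 2) * ∫ z, ⟪η, z⟫ ^ 2 ∂Q + c ^ 2 / 2 * ∫ z, ⟪η, z⟫ ^ 4 ∂Q +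
        32 * c ^ 2 * τ ^ 2 * ∫ z, ⟪η, z⟫ ^ 2 * ‖z‖ ^ 2 ∂Q + 46 * c ^ 2 * τ ^ 4 * ∫ z, ‖z‖ ^ 4 ∂Q := by
    have : ∀ z, meanExcess c τ ⟪η, z⟫ ‖z‖ = (-c + c ^ 2 / 2) + (c - c ^ 2) * ⟪η, z⟫ ^ 2 +
        c ^ 2 / 2 * ⟪η, z⟫ ^ 4 + 32 * c ^ 2 * τ ^ 2 * (⟪η, z⟫ ^ 2 * ‖z‖ ^ 2) +
        46 * c ^ 2 * τ ^ 4 * ‖z‖ ^ 4 := fun z => by unfold meanExcess; ring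
    simp_rw [this]
    have i1 : Integrable (fun z => (-c + c ^ 2 / 2) + (c - c ^ 2) * ⟪η, z⟫ ^ 2) Q :=
      (integrable_const _).add (h20.const_mul _)
    have i2 : Integrable (fun z => (-c + c ^ 2 / 2) + (c - c ^ 2) * ⟪η, z⟫ ^ 2 +
        c ^ 2 / 2 * ⟪η, z⟫ ^ 4) Q := i1.add (h40.const_mul _)
    have i3 : Integrable (fun z => (-c + c ^ 2 / 2) + (c - c ^ 2) * ⟪η, z⟫ ^ 2 +
        c ^ 2 / 2 * ⟪η, z⟫ ^ 4 + 32 * c ^ 2 * τ ^ 2 * (⟪η, z⟫ ^ 2 * ‖z‖ ^ 2)) Q :=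
      i2.add (h22.const_mul _)
    rw [integral_add i3 (h04.const_mul _), integral_add i2 (h22.const_mul _),
      integral_add i1 (h40.const_mul _), integral_add (integrable_const _) (h20.const_mul _)]
    simp only [integral_const_mul]
    simp
  have hmix : ∫ z, ⟪η, z⟫ ^ 2 * ‖z‖ ^ 2 ∂Q ≤ κ * d * t := by
    have hi : ∀ j : Fin d, Integrable (fun z : E => (⟪η, z⟫ ^ 4 / t + t * z j ^ 4) / 2) Q :=
      fun j => ((h40.div_const t).add ((hc4 j).const_mul t)).div_const 2
    calc ∫ z, ⟪η, z⟫ ^ 2 * ‖z‖ ^ 2 ∂Q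
        ≤ ∫ z, ∑ j : Fin d, (⟪η, z⟫ ^ 4 / t + t * z j ^ 4) / 2 ∂Q := by
          refine integral_mono h22 (integrable_finsetSum _ fun j _ => hi j) fun z => ?_
          simp only
          rw [EuclideanSpace.real_norm_sq_eq, Finset.mul_sum]
          refine Finset.sum_le_sum fun j _ => ?_
          rw [← sub_nonneg]
          have : (⟪η, z⟫ ^ 4 / t + t * z j ^ 4) / 2 - ⟪η, z⟫ ^ 2 * z j ^ 2 =
              (⟪η, z⟫ ^ 2 - t * z j ^ 2) ^ 2 / (2 * t) := by field_simp; ring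
          rw [this]; positivity
      _ = ∑ j : Fin d, ((∫ z, ⟪η, z⟫ ^ 4 ∂Q) / t + t * ∫ z, z j ^ 4 ∂Q) / 2 := by
          rw [integral_finsetSum _ fun j _ => hi j]
          refine Finset.sum_congr rfl fun j _ => ?_
          rw [integral_div, integral_add (h40.div_const t) ((hc4 j).const_mul t), integral_div,
            integral_const_mul]
      _ ≤ ∑ _j : Fin d, κ * t := by
          refine Finset.sum_le_sum fun j _ => ?_
          have h1 : (∫ z, ⟪η, z⟫ ^ 4 ∂Q) / t ≤ κ * t := by
            rw [div_le_iff₀ ht]; linarith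
          have h2 := mul_le_mul_of_nonneg_left (hcoord j) ht.le
          linarith
      _ = κ * d * t := by simp; ring
  have hnorm : ∫ z, ‖z‖ ^ 4 ∂Q ≤ κ * d ^ 2 := by
    have hi : Integrable (fun z : E => d * ∑ j : Fin d, z j ^ 4) Q :=
      (integrable_finsetSum _ fun j _ => hc4 j).const_mul _
    calc ∫ z, ‖z‖ ^ 4 ∂Q ≤ ∫ z, d * ∑ j : Fin d, z j ^ 4 ∂Q := by
          refine integral_mono h04 hi fun z => ?_
          have := sq_sum_le_card_mul_sum_sq (s := Finset.univ) (f := fun j : Fin d => z j ^ 2)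
          rw [← EuclideanSpace.real_norm_sq_eq, Finset.card_univ, Fintype.card_fin] at this
          simpa [← pow_mul] using this
      _ = d * ∑ j : Fin d, ∫ z, z j ^ 4 ∂Q := by
          rw [integral_const_mul, integral_finsetSum _ fun j _ => hc4 j]
      _ ≤ d * ∑ _j : Fin d, κ := by gcongr with j; exact hcoord j
      _ = κ * d ^ 2 := by simp; ring
  rw [hmean, h2]
  have e1 := mul_le_mul_of_nonneg_left h4 (by positivity : 0 ≤ c ^ 2 / 2)
  have e2 := mul_le_mul_of_nonneg_left hmix (by positivity : 0 ≤ 32 * c ^ 2 * τ ^ 2)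
  have e3 := mul_le_mul_of_nonneg_left hnorm (by positivity : 0 ≤ 46 * c ^ 2 * τ ^ 4)
  linarith

end PacBayes

/-! ### The choice of τ², and the sign of the bound at 1 ± δ̂ -/

section Constants

variable {d n : ℕ} {κ ε : ℝ}

theorem cast_pos_of_sampleSizeCondition (hs : SampleSizeCondition d n κ ε) : (0 : ℝ) < n :=
  (sq_nonneg _).trans_lt hs

theorem scale_nonneg : 0 ≤ scale d n κ ε := Real.sqrt_nonneg _

theorem scale_sq (hκ : 1 < κ) (hL : 0 ≤ confTerm d ε) :
    scale d n κ ε ^ 2 = 2 / ((κ - 1) * n) * confTerm d ε := by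
  have : 0 < κ - 1 := sub_pos.2 hκ
  exact Real.sq_sqrt (by positivity)

theorem scale_pos (hκ : 1 < κ) (hL : 0 < confTerm d ε) (hn : (0 : ℝ) < n) :
    0 < scale d n κ ε := by
  have : 0 < κ - 1 := sub_pos.2 hκ
  exact Real.sqrt_pos.2 (by positivity)

theorem sub_one_mul_scale (hκ : 1 < κ) :
    (κ - 1) * scale d n κ ε = √(2 * (κ - 1) / n * confTerm d ε) := by
  have h1 : 0 < κ - 1 := sub_pos.2 hκ
  rw [show 2 * (κ - 1) / n * confTerm d ε = (κ - 1) ^ 2 * (2 / ((κ - 1) * n) * confTerm d ε) by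
    field_simp, Real.sqrt_mul (sq_nonneg _), Real.sqrt_sq h1.le, scale]

theorem mu_eq (hκ : 1 < κ) :
    mu d n κ ε = (κ - 1) * scale d n κ ε + 6.81 * √2 * √(κ * d / n) := by
  rw [sub_one_mul_scale hκ, mu, mul_assoc 6.81, ← Real.sqrt_mul zero_le_two]
  congr 3
  ring

theorem sampleSize_bound (hκ : 1 < κ) (hs : SampleSizeCondition d n κ ε) :
    20 * √(κ * d / n) + 5 / 2 * ((κ - 1) * scale d n κ ε) + scale d n κ ε / 2 < 1 := by
  have hn := cast_pos_of_sampleSizeCondition hs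
  have h1 : 0 < κ - 1 := sub_pos.2 hκ
  have h2 : 20 * √(κ * d) + (5 / 2 + 1 / (2 * (κ - 1))) * √(2 * (κ - 1) * confTerm d ε) < √n := by
    refine lt_of_pow_lt_pow_left₀ 2 (Real.sqrt_nonneg _) ?_
    rw [Real.sq_sqrt hn.le]
    exact hs
  have hsn : 0 < √(n : ℝ) := Real.sqrt_pos.2 hn
  have h3 : √(κ * d / n) = √(κ * d) / √n := Real.sqrt_div' _ hn.le
  have h4 : (κ - 1) * scale d n κ ε = √(2 * (κ - 1) * confTerm d ε) / √n := by
    rw [← Real.sqrt_div' _ hn.le, sub_one_mul_scale hκ]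
    congr 1
    ring
  have h5 : scale d n κ ε = √(2 * (κ - 1) * confTerm d ε) / √n / (κ - 1) := by
    rw [← h4]; field_simp
  rw [← div_lt_one hsn] at h2
  have h6 : 20 * √(κ * d / n) + 5 / 2 * ((κ - 1) * scale d n κ ε) + scale d n κ ε / 2 =
      (20 * √(κ * d) + (5 / 2 + 1 / (2 * (κ - 1))) * √(2 * (κ - 1) * confTerm d ε)) / √n := by
    rw [h4, h5, h3]
    have := h1.ne'
    field_simp
    ring
  rw [h6]
  exact h2

/-- In `sampleSize_bound`, 20 exceeds 2 · 6.81 · √2, and 5/2 = 2 + 1/2 serves both μ and the extra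
term κλ/2. -/
theorem two_mul_mu_add_lt_one (hκ : 1 < κ) (hs : SampleSizeCondition d n κ ε) :
    2 * mu d n κ ε + ((κ - 1) * scale d n κ ε + scale d n κ ε) / 2 < 1 := by
  have h := sampleSize_bound hκ hs
  rw [mu_eq hκ]
  have h2 : √2 < 1.4143 := by
    rw [Real.sqrt_lt' (by norm_num)]; norm_num
  have h3 := Real.sqrt_nonneg (κ * d / n)
  nlinarith

theorem mu_nonneg : 0 ≤ mu d n κ ε := by
  unfold mu; positivity

theorem one_sub_two_mul_mu_pos (hκ : 1 < κ) (hs : SampleSizeCondition d n κ ε) :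
    0 < 1 - 2 * mu d n κ ε := by
  have h1 := two_mul_mu_add_lt_one hκ hs
  have h2 := scale_nonneg (d := d) (n := n) (κ := κ) (ε := ε)
  nlinarith [sub_pos.2 hκ]

theorem mu_pos (hκ : 1 < κ) (hL : 0 < confTerm d ε) (hn : (0 : ℝ) < n) : 0 < mu d n κ ε := by
  rw [mu_eq hκ]
  have h1 := scale_pos hκ hL hn
  have : 0 < κ - 1 := sub_pos.2 hκ
  positivity

theorem deltaHat_pos (hκ : 1 < κ) (hL : 0 < confTerm d ε) (hs : SampleSizeCondition d n κ ε) :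
    0 < deltaHat d n κ ε :=
  div_pos (mu_pos hκ hL (cast_pos_of_sampleSizeCondition hs)) (one_sub_two_mul_mu_pos hκ hs)

theorem deltaHat_eq (hκ : 1 < κ) (hs : SampleSizeCondition d n κ ε) :
    deltaHat d n κ ε = mu d n κ ε + 2 * mu d n κ ε * deltaHat d n κ ε := by
  have h : deltaHat d n κ ε * (1 - 2 * mu d n κ ε) = mu d n κ ε :=
    div_mul_cancel₀ _ (one_sub_two_mul_mu_pos hκ hs).ne'
  linarith

/-- δ̂(1 - 2μ) = μ, while κλ/2 < 1 - 2μ. -/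
theorem half_scale_mul_deltaHat_lt (hκ : 1 < κ) (hL : 0 < confTerm d ε)
    (hs : SampleSizeCondition d n κ ε) :
    ((κ - 1) * scale d n κ ε + scale d n κ ε) / 2 * deltaHat d n κ ε < mu d n κ ε := by
  have h1 := two_mul_mu_add_lt_one hκ hs
  have h2 := deltaHat_pos hκ hL hs
  have h3 := deltaHat_eq hκ hs
  nlinarith

/-- The perturbation scale `τ²` balancing the entropy and the variance of the perturbation. -/
noncomputable def noiseVar (d n : ℕ) (κ ε : ℝ) : ℝ := (8 * scale d n κ ε * √(n * κ * d))⁻¹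

/-- This τ² makes the mixed variance term and the entropy both equal to 4nλt√(κd/n), whence the 8.
The τ⁴ term equals (46/64)d ≤ 0.73d, which the dimensional part of `confTerm` absorbs, and
`confTerm` itself is nλ²(κ-1)/2. -/
theorem pac_bound_le (hκ : 1 < κ) (hL : 0 < confTerm d ε) (hn : (0 : ℝ) < n) (hd : 0 < d) {c : ℝ}
    (hc : c ^ 2 = scale d n κ ε ^ 2) {t : ℝ} :
    n * (c * (t - 1) + c ^ 2 / 2 * (κ * t ^ 2 - 2 * t + 1) +
        32 * c ^ 2 * noiseVar d n κ ε * (κ * d * t) +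
        46 * c ^ 2 * noiseVar d n κ ε ^ 2 * (κ * d ^ 2)) +
        Real.log ε⁻¹ + t / (2 * noiseVar d n κ ε) ≤
      n * (c * (t - 1) + scale d n κ ε * (scale d n κ ε / 2 * ((κ - 1) * t ^ 2 + (t - 1) ^ 2) +
        8 * t * √(κ * d / n) + (κ - 1) * scale d n κ ε / 2)) := by
  have h1 : 0 < κ - 1 := sub_pos.2 hκ
  have hd' : (0 : ℝ) < d := by exact_mod_cast hd
  have hl := scale_pos hκ hL hn
  have hsq := scale_sq (n := n) hκ hL.le
  have hlog : Real.log ε⁻¹ = confTerm d ε - 0.73 * d := by unfold confTerm; ring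
  have hLeq : confTerm d ε = scale d n κ ε ^ 2 * (κ - 1) * n / 2 := by
    rw [hsq]; field_simp
  have hc0 : √(κ * d / n) = √(n * κ * d) / n := by
    rw [show κ * d / n = n * κ * d / (n : ℝ) ^ 2 by field_simp, Real.sqrt_div' _ (sq_nonneg _),
      Real.sqrt_sq hn.le]
  have hr : 0 < √(n * κ * d) := Real.sqrt_pos.2 (by positivity)
  have hr2 : √(n * κ * d) ^ 2 = n * κ * d := Real.sq_sqrt (by positivity)
  rw [hlog, hLeq, hc0, hc]
  unfold noiseVar
  set l := scale d n κ ε with hl'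
  set r := √(n * κ * d) with hr'
  have hκd : κ * d = r ^ 2 / n := by rw [hr2]; field_simp
  have e1 : 32 * l ^ 2 * (8 * l * r)⁻¹ * (κ * d * t) = 4 * l * t * (r / n) := by
    rw [hκd]; field_simp; ring
  have e2 : 46 * l ^ 2 * (8 * l * r)⁻¹ ^ 2 * (κ * d ^ 2) = 46 / 64 * d / n := by
    rw [show κ * (d : ℝ) ^ 2 = (κ * d) * d by ring, hκd]; field_simp; norm_num
  have e3 : t / (2 * (8 * l * r)⁻¹) = n * (l * (4 * t * (r / n))) := by
    field_simp; ring
  rw [e1, e2, e3]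
  have e4 : (n : ℝ) * (46 / 64 * d / n) = 46 / 64 * d := by field_simp
  have e5 : n * (c * (t - 1) + l * (l / 2 * ((κ - 1) * t ^ 2 + (t - 1) ^ 2) + 8 * t * (r / n) +
      (κ - 1) * l / 2)) - (n * (c * (t - 1) + l ^ 2 / 2 * (κ * t ^ 2 - 2 * t + 1) +
      4 * l * t * (r / n) + 46 / 64 * d / n) + (l ^ 2 * (κ - 1) * n / 2 - 0.73 * d) +
      n * (l * (4 * t * (r / n)))) = 0.73 * d - n * (46 / 64 * d / n) := by ring
  rw [e4] at e5
  norm_num at e5 ⊢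
  linarith

/-- Since 8 ≤ 6.81√2, the expression is at most -δ̂ + μ(1+δ̂) + κλδ̂²/2. The last term is below μδ̂,
and -δ̂ + μ + 2μδ̂ = 0. -/
theorem lower_level_neg (hκ : 1 < κ) (hL : 0 < confTerm d ε) (hs : SampleSizeCondition d n κ ε) :
    -deltaHat d n κ ε + (scale d n κ ε / 2 *
      ((κ - 1) * (1 + deltaHat d n κ ε) ^ 2 + (1 + deltaHat d n κ ε - 1) ^ 2) +
        8 * (1 + deltaHat d n κ ε) * √(κ * d / n) + (κ - 1) * scale d n κ ε / 2) < 0 := by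
  have h1 := half_scale_mul_deltaHat_lt hκ hL hs
  have h2 := deltaHat_pos hκ hL hs
  have h3 := deltaHat_eq hκ hs
  have h4 := mu_eq (d := d) (n := n) (ε := ε) hκ
  have h5 : 1.4 < √2 := by
    rw [Real.lt_sqrt (by norm_num)]; norm_num
  have h6 := Real.sqrt_nonneg (κ * d / n)
  have h7 : 8 * √(κ * d / n) ≤ 6.81 * √2 * √(κ * d / n) := by
    gcongr; linarith
  set δ := deltaHat d n κ ε
  set l := scale d n κ ε
  set m := mu d n κ ε
  have h8 := mul_lt_mul_of_pos_right h1 h2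
  have h9 := mul_le_mul_of_nonneg_right h7 (by linarith : 0 ≤ 1 + δ)
  have h10 : 6.81 * √2 * √(κ * d / n) * (1 + δ) = (m - (κ - 1) * l) * (1 + δ) := by rw [h4]; ring
  nlinarith

/-- The factors 1 - δ̂ are bounded by 1 and λδ̂²/2 by μδ̂, leaving -δ̂ + μ + μδ̂ = -μδ̂. -/
theorem upper_level_nonpos (hκ : 1 < κ) (hL : 0 < confTerm d ε) (hs : SampleSizeCondition d n κ ε)
    (hδ : deltaHat d n κ ε < 1) :
    -deltaHat d n κ ε + (scale d n κ ε / 2 *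
      ((κ - 1) * (1 - deltaHat d n κ ε) ^ 2 + (1 - deltaHat d n κ ε - 1) ^ 2) +
        8 * (1 - deltaHat d n κ ε) * √(κ * d / n) + (κ - 1) * scale d n κ ε / 2) ≤ 0 := by
  have h1 := half_scale_mul_deltaHat_lt hκ hL hs
  have h2 := deltaHat_pos hκ hL hs
  have h3 := deltaHat_eq hκ hs
  have h4 := mu_eq (d := d) (n := n) (ε := ε) hκ
  have hκ' : 0 < κ - 1 := sub_pos.2 hκ
  have hm := mu_pos hκ hL (cast_pos_of_sampleSizeCondition hs)
  have hl := scale_pos hκ hL (cast_pos_of_sampleSizeCondition hs)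
  have h5 : 1.4 < √2 := by
    rw [Real.lt_sqrt (by norm_num)]; norm_num
  have h6 := Real.sqrt_nonneg (κ * d / n)
  have h7 : 8 * √(κ * d / n) ≤ 6.81 * √2 * √(κ * d / n) := by
    gcongr; linarith
  set δ := deltaHat d n κ ε
  set l := scale d n κ ε
  set m := mu d n κ ε
  have h8 : 8 * (1 - δ) * √(κ * d / n) ≤ 6.81 * √2 * √(κ * d / n) := by
    nlinarith
  have h9 : l / 2 * ((κ - 1) * (1 - δ) ^ 2) ≤ (κ - 1) * l / 2 := by
    have : (1 - δ) ^ 2 ≤ 1 := by nlinarith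
    have := mul_le_mul_of_nonneg_left this (by positivity : 0 ≤ (κ - 1) * l / 2)
    linarith
  have h10 : l / 2 * δ < m := by
    have : 0 < (κ - 1) * l / 2 * δ := by positivity
    linarith
  have h11 := mul_lt_mul_of_pos_right h10 h2
  have h12 : 0 < m * δ := by positivity
  nlinarith

end Constants

/-! ### Whitening by the pseudo-inverse square root of G -/

section Whitening

variable {d : ℕ} {P : Measure (EuclideanSpace ℝ (Fin d))}

local notation "E" => EuclideanSpace ℝ (Fin d)

/-- The orthonormal eigenbasis of the Gram matrix. -/
noncomputable def gramBasis (P : Measure (EuclideanSpace ℝ (Fin d))) :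
    OrthonormalBasis (Fin d) ℝ (EuclideanSpace ℝ (Fin d)) :=
  (gram_isHermitian P).eigenvectorBasis

/-- The eigenvalues of the Gram matrix. -/
noncomputable def gramEigenvalue (P : Measure (EuclideanSpace ℝ (Fin d))) (i : Fin d) : ℝ :=
  (gram_isHermitian P).eigenvalues i

/-- The eigenvalues of `G^{-1/2}`. -/
noncomputable def invSqrtEigenvalue (P : Measure (EuclideanSpace ℝ (Fin d))) (i : Fin d) : ℝ :=
  if 0 < gramEigenvalue P i then (√(gramEigenvalue P i))⁻¹ else 0

/-- The vector `G^{-1/2} x`. -/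
noncomputable def whiten (P : Measure (EuclideanSpace ℝ (Fin d)))
    (x : EuclideanSpace ℝ (Fin d)) : EuclideanSpace ℝ (Fin d) :=
  WithLp.toLp 2 (gramInvSqrt P *ᵥ x.ofLp)

/-- The vector `G^{1/2} θ`. -/
noncomputable def colour (P : Measure (EuclideanSpace ℝ (Fin d)))
    (θ : EuclideanSpace ℝ (Fin d)) : EuclideanSpace ℝ (Fin d) :=
  ∑ i, (√(gramEigenvalue P i) * ⟪gramBasis P i, θ⟫) • gramBasis P i

theorem whiten_eq_sum (x : E) :
    whiten P x = ∑ i, (invSqrtEigenvalue P i * ⟪gramBasis P i, x⟫) • gramBasis P i := by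
  ext k
  simp only [whiten, gramInvSqrt, ← Matrix.mulVec_mulVec, WithLp.ofLp_sum, WithLp.ofLp_smul,
    Finset.sum_apply, Pi.smul_apply, smul_eq_mul]
  simp only [Matrix.mulVec, dotProduct, Matrix.diagonal_apply, ite_mul, zero_mul,
    Finset.sum_ite_eq, Finset.mem_univ, if_true, Matrix.transpose_apply,
    Matrix.IsHermitian.eigenvectorUnitary_apply]
  refine Finset.sum_congr rfl fun i _ => ?_
  have hc : invSqrtEigenvalue P i = if 0 < (gram_isHermitian P).eigenvalues i
      then (√((gram_isHermitian P).eigenvalues i))⁻¹ else 0 := rfl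
  simp only [hc, gramBasis, PiLp.inner_apply, RCLike.inner_apply,
    conj_trivial]
  rw [mul_comm]
  simp only [mul_comm]
  by_cases h : 0 < (gram_isHermitian P).eigenvalues i
  · rw [if_pos h, if_pos h]
  · rw [if_neg h, if_neg h, zero_mul]

theorem measurable_whiten : Measurable (whiten P) := by
  have : whiten P = fun x => ∑ i, (invSqrtEigenvalue P i * ⟪gramBasis P i, x⟫) • gramBasis P i :=
    funext whiten_eq_sum
  rw [this]
  fun_prop

theorem inner_gramBasis_whiten (x : E) (i : Fin d) :
    ⟪gramBasis P i, whiten P x⟫ = invSqrtEigenvalue P i * ⟪gramBasis P i, x⟫ := by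
  rw [whiten_eq_sum, (gramBasis P).orthonormal.inner_right_fintype]

theorem inner_gramBasis_colour (x : E) (i : Fin d) :
    ⟪gramBasis P i, colour P x⟫ = √(gramEigenvalue P i) * ⟪gramBasis P i, x⟫ := by
  rw [colour, (gramBasis P).orthonormal.inner_right_fintype]

theorem inner_eq_sum_gramBasis (u v : E) :
    ⟪u, v⟫ = ∑ i, ⟪gramBasis P i, u⟫ * ⟪gramBasis P i, v⟫ := by
  rw [← (gramBasis P).sum_inner_mul_inner u v]
  exact Finset.sum_congr rfl fun i _ => by rw [real_inner_comm]

theorem norm_sq_eq_sum_gramBasis (u : E) : ‖u‖ ^ 2 = ∑ i, ⟪gramBasis P i, u⟫ ^ 2 := by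
  rw [← real_inner_self_eq_norm_sq, inner_eq_sum_gramBasis (P := P)]
  exact Finset.sum_congr rfl fun i _ => (sq _).symm

theorem inner_whiten (u x : E) : ⟪u, whiten P x⟫ = ⟪whiten P u, x⟫ := by
  rw [inner_eq_sum_gramBasis (P := P), inner_eq_sum_gramBasis (P := P)]
  refine Finset.sum_congr rfl fun i _ => ?_
  rw [inner_gramBasis_whiten, inner_gramBasis_whiten]
  ring

theorem memLp_two_inner (hP : MemLp id 2 P) (u : E) : MemLp (fun x => ⟪u, x⟫) 2 P :=
  hP.const_inner u

theorem integral_inner_mul_inner (hP : MemLp id 2 P) (u v : E) :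
    ∫ x, ⟪u, x⟫ * ⟪v, x⟫ ∂P = u.ofLp ⬝ᵥ (gram P *ᵥ v.ofLp) := by
  have hi : ∀ j k : Fin d, Integrable (fun x : E => x j * x k) P := fun j k => by
    have h := (memLp_two_inner hP (EuclideanSpace.single j 1)).integrable_mul
      (memLp_two_inner hP (EuclideanSpace.single k 1))
    simpa [EuclideanSpace.inner_single_left, Pi.mul_def] using h
  have h : ∀ x : E, ⟪u, x⟫ * ⟪v, x⟫ = ∑ j, ∑ k, u j * v k * (x j * x k) := fun x => by
    simp only [PiLp.inner_apply, RCLike.inner_apply, conj_trivial]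
    rw [Finset.sum_mul_sum]
    exact Finset.sum_congr rfl fun j _ => Finset.sum_congr rfl fun k _ => by ring
  simp_rw [h]
  rw [integral_finsetSum _ fun j _ => integrable_finsetSum _ fun k _ => (hi j k).const_mul _]
  simp only [dotProduct, Matrix.mulVec, Finset.mul_sum]
  refine Finset.sum_congr rfl fun j _ => ?_
  rw [integral_finsetSum _ fun k _ => (hi j k).const_mul _]
  refine Finset.sum_congr rfl fun k _ => ?_
  rw [integral_const_mul, gram, Matrix.of_apply]
  ring

theorem integral_inner_gramBasis_mul (hP : MemLp id 2 P) (i k : Fin d) :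
    ∫ x, ⟪gramBasis P i, x⟫ * ⟪gramBasis P k, x⟫ ∂P = if i = k then gramEigenvalue P k else 0 := by
  rw [integral_inner_mul_inner hP]
  have h1 : gram P *ᵥ (gramBasis P k).ofLp = gramEigenvalue P k • (gramBasis P k).ofLp :=
    (gram_isHermitian P).mulVec_eigenvectorBasis k
  have h2 : (gramBasis P i).ofLp ⬝ᵥ (gramBasis P k).ofLp = ⟪gramBasis P i, gramBasis P k⟫ := by
    simp only [dotProduct, PiLp.inner_apply, RCLike.inner_apply, conj_trivial]
    exact Finset.sum_congr rfl fun j _ => mul_comm _ _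
  rw [h1, dotProduct_smul, h2, (gramBasis P).inner_eq_ite]
  split_ifs <;> simp

theorem integral_inner_gramBasis_sq (hP : MemLp id 2 P) (i : Fin d) :
    ∫ x, ⟪gramBasis P i, x⟫ ^ 2 ∂P = gramEigenvalue P i := by
  simp_rw [sq]
  rw [integral_inner_gramBasis_mul hP, if_pos rfl]

theorem gramEigenvalue_nonneg (hP : MemLp id 2 P) (i : Fin d) : 0 ≤ gramEigenvalue P i := by
  rw [← integral_inner_gramBasis_sq hP]
  exact integral_nonneg fun x => sq_nonneg _

theorem energy_eq_sum (hP : MemLp id 2 P) (θ : E) :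
    energy P θ = ∑ i, gramEigenvalue P i * ⟪gramBasis P i, θ⟫ ^ 2 := by
  have hi : ∀ i k : Fin d, Integrable (fun x : E => ⟪gramBasis P i, x⟫ * ⟪gramBasis P k, x⟫) P :=
    fun i k => (memLp_two_inner hP _).integrable_mul (memLp_two_inner hP _)
  have h : ∀ x : E, ⟪θ, x⟫ ^ 2 = ∑ i, ∑ k, ⟪gramBasis P i, θ⟫ * ⟪gramBasis P k, θ⟫ *
      (⟪gramBasis P i, x⟫ * ⟪gramBasis P k, x⟫) := fun x => by
    rw [inner_eq_sum_gramBasis (P := P), sq, Finset.sum_mul_sum]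
    exact Finset.sum_congr rfl fun j _ => Finset.sum_congr rfl fun k _ => by ring
  unfold energy
  simp_rw [h]
  rw [integral_finsetSum _ fun j _ => integrable_finsetSum _ fun k _ => (hi j k).const_mul _]
  refine Finset.sum_congr rfl fun j _ => ?_
  rw [integral_finsetSum _ fun k _ => (hi j k).const_mul _]
  simp_rw [integral_const_mul, integral_inner_gramBasis_mul hP]
  simp
  ring

theorem norm_colour_sq (hP : MemLp id 2 P) (θ : E) : ‖colour P θ‖ ^ 2 = energy P θ := by
  rw [norm_sq_eq_sum_gramBasis (P := P), energy_eq_sum hP]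
  refine Finset.sum_congr rfl fun i _ => ?_
  rw [inner_gramBasis_colour, mul_pow, Real.sq_sqrt (gramEigenvalue_nonneg hP i)]

/-- `whiten` loses the directions with nonpositive eigenvalue, where x has no component; on the
others the two square roots cancel. -/
theorem inner_colour_whiten {x : E}
    (hx : ∀ i, gramEigenvalue P i ≤ 0 → ⟪gramBasis P i, x⟫ = 0) (θ : E) :
    ⟪colour P θ, whiten P x⟫ = ⟪θ, x⟫ := by
  rw [inner_eq_sum_gramBasis (P := P), inner_eq_sum_gramBasis (P := P) θ x]
  refine Finset.sum_congr rfl fun i _ => ?_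
  rw [inner_gramBasis_whiten, inner_gramBasis_colour, invSqrtEigenvalue]
  split_ifs with h
  · have := (Real.sqrt_pos.2 h).ne'
    field_simp
  · rw [hx i (not_lt.1 h)]; simp

theorem ae_inner_gramBasis_eq_zero (hP : MemLp id 2 P) :
    ∀ᵐ x ∂P, ∀ i, gramEigenvalue P i ≤ 0 → ⟪gramBasis P i, x⟫ = 0 := by
  rw [ae_all_iff]
  intro i
  by_cases h : gramEigenvalue P i ≤ 0
  · have h0 : ∫ x, ⟪gramBasis P i, x⟫ ^ 2 ∂P = 0 := by
      rw [integral_inner_gramBasis_sq hP]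
      exact le_antisymm h (gramEigenvalue_nonneg hP i)
    rw [integral_eq_zero_iff_of_nonneg (fun x => sq_nonneg _)
      (memLp_two_inner hP _).integrable_sq] at h0
    filter_upwards [h0] with x hx _
    simpa using hx
  · exact Filter.Eventually.of_forall fun x hx => absurd hx h

theorem energy_nonneg (θ : E) : 0 ≤ energy P θ := integral_nonneg fun _ => sq_nonneg _

theorem energy_smul (c : ℝ) (θ : E) : energy P (c • θ) = c ^ 2 * energy P θ := by
  unfold energy
  simp_rw [real_inner_smul_left, mul_pow]
  rw [integral_const_mul]

/-- G^{-1/2}GG^{-1/2} is an orthogonal projection. This makes the kurtosis bound available for each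
whitened coordinate. -/
theorem energy_whiten_single_le (hP : MemLp id 2 P) (j : Fin d) :
    energy P (whiten P (EuclideanSpace.single j 1)) ≤ 1 := by
  have h1 : ‖(EuclideanSpace.single j (1 : ℝ) : E)‖ ^ 2 = 1 := by simp
  rw [norm_sq_eq_sum_gramBasis (P := P)] at h1
  refine le_of_le_of_eq ?_ h1
  rw [energy_eq_sum hP]
  refine Finset.sum_le_sum fun i _ => ?_
  rw [inner_gramBasis_whiten, mul_pow, ← mul_assoc, invSqrtEigenvalue]
  split_ifs with h
  · rw [inv_pow, Real.sq_sqrt h.le, mul_inv_cancel₀ h.ne', one_mul]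
  · simpa using sq_nonneg _

theorem whiten_apply (x : E) (j : Fin d) :
    whiten P x j = ⟪whiten P (EuclideanSpace.single j 1), x⟫ := by
  rw [← inner_whiten, EuclideanSpace.inner_single_left]
  simp

theorem lintegral_inner_pow_four_le {κ : ℝ} (hκ : kurtosis P ≤ ENNReal.ofReal κ) {θ : E}
    (hθ : energy P θ ≤ 1) : ∫⁻ x, ENNReal.ofReal (⟪θ, x⟫ ^ 4) ∂P ≤ ENNReal.ofReal κ :=
  (le_iSup₂ (f := fun (θ : E) (_ : energy P θ ≤ 1) => ∫⁻ x, ENNReal.ofReal (⟪θ, x⟫ ^ 4) ∂P)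
    θ hθ).trans hκ

theorem integral_inner_pow_four_le_of_energy_le_one {κ : ℝ} (hκ0 : 0 ≤ κ)
    (hκ : kurtosis P ≤ ENNReal.ofReal κ) {θ : E} (hθ : energy P θ ≤ 1) :
    ∫ x, ⟪θ, x⟫ ^ 4 ∂P ≤ κ := by
  rw [integral_eq_lintegral_of_nonneg_ae (Filter.Eventually.of_forall fun x => by positivity)
    (by fun_prop)]
  exact ENNReal.toReal_le_of_le_ofReal hκ0 (lintegral_inner_pow_four_le hκ hθ)

theorem integral_inner_pow_four_le {κ : ℝ} (hκ0 : 0 ≤ κ) (hκ : kurtosis P ≤ ENNReal.ofReal κ)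
    {θ : E} (hθ : 0 < energy P θ) : ∫ x, ⟪θ, x⟫ ^ 4 ∂P ≤ κ * energy P θ ^ 2 := by
  set s := √(energy P θ) with hs
  have hs0 : 0 < s := Real.sqrt_pos.2 hθ
  have hs2 : s ^ 2 = energy P θ := Real.sq_sqrt hθ.le
  have h1 : energy P (s⁻¹ • θ) ≤ 1 := by
    rw [energy_smul, inv_pow, hs2, inv_mul_cancel₀ hθ.ne']
  have h2 := integral_inner_pow_four_le_of_energy_le_one hκ0 hκ h1
  simp_rw [real_inner_smul_left, mul_pow] at h2
  rw [integral_const_mul, inv_pow, inv_mul_le_iff₀ (by positivity)] at h2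
  rw [← hs2]
  linarith

/-- Only second moments of X are assumed; finiteness of the fourth comes from the kurtosis bound,
which is stated for lower integrals. -/
theorem memLp_four_whiten (hP : MemLp id 2 P) {κ : ℝ} (hκ : kurtosis P ≤ ENNReal.ofReal κ) :
    MemLp id 4 (P.map (whiten P)) := by
  rw [memLp_map_measure_iff (by fun_prop) measurable_whiten.aemeasurable, Function.id_comp]
  refine memLp_piLp_iff.2 fun j => ?_
  simp_rw [whiten_apply]
  refine (integrable_norm_rpow_iff (by fun_prop) (by norm_num) (by norm_num)).1 ?_
  have h4 : (4 : ℝ≥0∞).toReal = (4 : ℕ) := by norm_num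
  simp_rw [h4, Real.rpow_natCast]
  refine ⟨by fun_prop, ?_⟩
  rw [hasFiniteIntegral_iff_ofReal (Filter.Eventually.of_forall fun x => by positivity)]
  refine lt_of_le_of_lt ?_ (ENNReal.ofReal_lt_top (r := κ))
  refine le_of_eq_of_le ?_ (lintegral_inner_pow_four_le hκ (energy_whiten_single_le hP j))
  refine lintegral_congr fun x => ?_
  rw [Real.norm_eq_abs, Even.pow_abs (by decide : Even 4)]

theorem integral_coord_pow_four_le (hP : MemLp id 2 P) {κ : ℝ} (hκ0 : 0 ≤ κ)
    (hκ : kurtosis P ≤ ENNReal.ofReal κ) (j : Fin d) :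
    ∫ z, z j ^ 4 ∂(P.map (whiten P)) ≤ κ := by
  rw [integral_map measurable_whiten.aemeasurable (by fun_prop)]
  simp_rw [whiten_apply]
  exact integral_inner_pow_four_le_of_energy_le_one hκ0 hκ (energy_whiten_single_le hP j)

end Whitening

/-! ### The event of probability at least 1 - 2ε -/

section DeviationEvent

variable {d n : ℕ} {P : Measure (EuclideanSpace ℝ (Fin d))} [IsProbabilityMeasure P] {κ ε : ℝ}

local notation "E" => EuclideanSpace ℝ (Fin d)

/-- All sample points lie in the range of the Gram matrix. -/
def IsRegularSample (P : Measure (EuclideanSpace ℝ (Fin d)))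
    (x : Fin n → EuclideanSpace ℝ (Fin d)) : Prop :=
  ∀ i k, gramEigenvalue P k ≤ 0 → ⟪gramBasis P k, x i⟫ = 0

theorem exists_isRegularSample_event (hP : MemLp id 2 P) :
    ∃ A : Set (Fin n → E), MeasurableSet A ∧ Measure.pi (fun _ : Fin n => P) Aᶜ = 0 ∧
      ∀ x ∈ A, IsRegularSample P x := by
  refine ⟨⋂ (i : Fin n) (k : Fin d) (_ : gramEigenvalue P k ≤ 0),
    {x | ⟪gramBasis P k, x i⟫ = 0}, ?_, ?_, ?_⟩
  · exact MeasurableSet.iInter fun i => MeasurableSet.iInter fun k => MeasurableSet.iInter fun _ =>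
      measurableSet_eq_fun (by fun_prop) measurable_const
  · rw [← mem_ae_iff]
    have h : ∀ᵐ x ∂Measure.pi (fun _ : Fin n => P), ∀ i k, gramEigenvalue P k ≤ 0 →
        ⟪gramBasis P k, x i⟫ = 0 := by
      rw [ae_all_iff]
      exact fun i => (measurePreserving_eval (fun _ : Fin n => P) i).quasiMeasurePreserving.ae
        (ae_inner_gramBasis_eq_zero hP)
    filter_upwards [h] with x hx
    simpa using hx
  · intro x hx i k hk
    simp only [Set.mem_iInter] at hx
    exact hx i k hk

theorem exists_pac_event (hP : MemLp id 2 P) (hκ : 1 < κ) (hκP : kurtosis P ≤ ENNReal.ofReal κ)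
    (hε : 0 < ε) (hL : 0 < confTerm d ε) (hn : (0 : ℝ) < n) (hd : 0 < d) {c : ℝ}
    (hc : c ^ 2 = scale d n κ ε ^ 2) :
    ∃ A : Set (Fin n → E), MeasurableSet A ∧
      Measure.pi (fun _ : Fin n => P) Aᶜ ≤ ENNReal.ofReal ε ∧
      ∀ x ∈ A, IsRegularSample P x → ∀ (θ : E) (ρ : ℝ), 0 < energy P θ → 0 < ρ →
        ∑ i, psi (c * (ρ⁻¹ * ⟪θ, x i⟫ ^ 2 - 1)) ≤
          n * (c * (energy P θ / ρ - 1) + scale d n κ ε * (scale d n κ ε / 2 *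
            ((κ - 1) * (energy P θ / ρ) ^ 2 + (energy P θ / ρ - 1) ^ 2) +
            8 * (energy P θ / ρ) * √(κ * d / n) + (κ - 1) * scale d n κ ε / 2)) := by
  have hκ0 : 0 ≤ κ := by linarith
  have hd' : (0 : ℝ) < d := by exact_mod_cast hd
  have hscale := scale_pos hκ hL hn
  have hv : 0 < noiseVar d n κ ε := by
    have : 0 < √(n * κ * d) := Real.sqrt_pos.2 (by positivity)
    unfold noiseVar; positivity
  have hτ : √(noiseVar d n κ ε) ≠ 0 := (Real.sqrt_pos.2 hv).ne'
  have hτ2 : √(noiseVar d n κ ε) ^ 2 = noiseVar d n κ ε := Real.sq_sqrt hv.le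
  have hτ4 : √(noiseVar d n κ ε) ^ 4 = noiseVar d n κ ε ^ 2 := by
    rw [show 4 = 2 * 2 by rfl, pow_mul, hτ2]
  have hQp : IsProbabilityMeasure (P.map (whiten P)) :=
    Measure.isProbabilityMeasure_map measurable_whiten.aemeasurable
  have hQ4 := memLp_four_whiten hP hκP
  obtain ⟨A, hA, hAP, hAb⟩ := exists_measurableSet_sum_psi_le hQ4 n c hτ hε
  have hpres : MeasurePreserving (fun (x : Fin n → E) i => whiten P (x i))
      (Measure.pi fun _ : Fin n => P) (Measure.pi fun _ : Fin n => P.map (whiten P)) :=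
    measurePreserving_pi _ _ fun _ => ⟨measurable_whiten, rfl⟩
  refine ⟨(fun (x : Fin n → E) i => whiten P (x i)) ⁻¹' A, hpres.measurable hA, ?_, ?_⟩
  · rw [← Set.preimage_compl, hpres.measure_preimage hA.compl.nullMeasurableSet]
    exact hAP
  · intro x hx hreg θ ρ hθ hρ
    -- This η absorbs both θ and ρ, so a bound uniform in η is uniform in the pair.
    set η : E := (√ρ)⁻¹ • colour P θ with hη
    have hsρ : √ρ ^ 2 = ρ := Real.sq_sqrt hρ.le
    have hin : ∀ z : E, (∀ k, gramEigenvalue P k ≤ 0 → ⟪gramBasis P k, z⟫ = 0) →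
        ⟪η, whiten P z⟫ ^ 2 = ρ⁻¹ * ⟪θ, z⟫ ^ 2 := fun z hz => by
      rw [hη, real_inner_smul_left, inner_colour_whiten hz, mul_pow, inv_pow, hsρ]
    have hae := ae_inner_gramBasis_eq_zero hP
    have ht : 0 < energy P θ / ρ := div_pos hθ hρ
    have hnorm : ‖η‖ ^ 2 = energy P θ / ρ := by
      rw [hη, norm_smul, mul_pow, norm_colour_sq hP, Real.norm_eq_abs, sq_abs, inv_pow, hsρ]
      ring
    have h2 : ∫ z, ⟪η, z⟫ ^ 2 ∂(P.map (whiten P)) = energy P θ / ρ := by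
      rw [integral_map measurable_whiten.aemeasurable (by fun_prop)]
      calc ∫ z, ⟪η, whiten P z⟫ ^ 2 ∂P = ∫ z, ρ⁻¹ * ⟪θ, z⟫ ^ 2 ∂P :=
            integral_congr_ae (hae.mono fun z hz => hin z hz)
        _ = energy P θ / ρ := by rw [integral_const_mul, energy]; ring
    have h4 : ∫ z, ⟪η, z⟫ ^ 4 ∂(P.map (whiten P)) ≤ κ * (energy P θ / ρ) ^ 2 := by
      rw [integral_map measurable_whiten.aemeasurable (by fun_prop)]
      calc ∫ z, ⟪η, whiten P z⟫ ^ 4 ∂P = ∫ z, ρ⁻¹ ^ 2 * ⟪θ, z⟫ ^ 4 ∂P := by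
            refine integral_congr_ae (hae.mono fun z hz => ?_)
            simp only
            rw [show 4 = 2 * 2 by rfl, pow_mul, hin z hz]
            ring
        _ = ρ⁻¹ ^ 2 * ∫ z, ⟪θ, z⟫ ^ 4 ∂P := integral_const_mul _ _
        _ ≤ ρ⁻¹ ^ 2 * (κ * energy P θ ^ 2) := by
            gcongr
            exact integral_inner_pow_four_le hκ0 hκP hθ
        _ = κ * (energy P θ / ρ) ^ 2 := by field_simp
    have hmean := integral_meanExcess_le hQ4 (integral_coord_pow_four_le hP hκ0 hκP) ht h2 h4 c
      √(noiseVar d n κ ε)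
    rw [hτ2, hτ4] at hmean
    have hb := hAb _ hx η
    simp_rw [hin _ (hreg _)] at hb
    rw [hnorm, hτ2] at hb
    have hfin := pac_bound_le (t := energy P θ / ρ) hκ hL hn hd hc
    have := mul_le_mul_of_nonneg_left hmean hn.le
    linarith

/-- On an event of probability at least `1 - 2ε`, the estimating equation changes sign in the
prescribed interval, simultaneously in all directions. -/
theorem exists_deviation_event (hP : MemLp id 2 P) (hκ : 1 < κ)
    (hκP : kurtosis P ≤ ENNReal.ofReal κ) (hε : 0 < ε) (hL : 0 < confTerm d ε)
    (hs : SampleSizeCondition d n κ ε) :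
    ∃ A : Set (Fin n → E), MeasurableSet A ∧
      Measure.pi (fun _ : Fin n => P) Aᶜ ≤ ENNReal.ofReal (2 * ε) ∧
      ∀ x ∈ A, IsRegularSample P x ∧ ∀ θ : E, 0 < energy P θ →
        0 < ∑ i, psi (scale d n κ ε *
          ((energy P θ / (1 + deltaHat d n κ ε))⁻¹ * ⟪θ, x i⟫ ^ 2 - 1)) ∧
        (deltaHat d n κ ε < 1 → ∑ i, psi (scale d n κ ε *
          ((energy P θ / (1 - deltaHat d n κ ε))⁻¹ * ⟪θ, x i⟫ ^ 2 - 1)) ≤ 0) := by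
  have hn := cast_pos_of_sampleSizeCondition hs
  have hδ := deltaHat_pos hκ hL hs
  have hscale := scale_pos hκ hL hn
  obtain ⟨A₀, hA₀, hA₀P, hA₀r⟩ := exists_isRegularSample_event (n := n) hP
  -- For d = 0 the noise variance would be 0, but no direction has positive energy.
  rcases Nat.eq_zero_or_pos d with rfl | hd
  · refine ⟨A₀, hA₀, by simp [hA₀P], fun x hx => ⟨hA₀r x hx, fun θ hθ => ?_⟩⟩
    have : energy P θ = 0 := by simp [energy, Subsingleton.elim θ 0]
    exact absurd hθ (by simp [this])
  obtain ⟨A₁, hA₁, hA₁P, hA₁b⟩ := exists_pac_event hP hκ hκP hε hL hn hd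
    (c := -scale d n κ ε) (neg_sq _)
  obtain ⟨A₂, hA₂, hA₂P, hA₂b⟩ := exists_pac_event hP hκ hκP hε hL hn hd
    (c := scale d n κ ε) rfl
  refine ⟨A₀ ∩ A₁ ∩ A₂, (hA₀.inter hA₁).inter hA₂, ?_, ?_⟩
  · rw [Set.compl_inter, Set.compl_inter]
    refine (measure_union_le _ _).trans ?_
    refine (add_le_add_left (measure_union_le _ _) _).trans ?_
    rw [hA₀P, zero_add, two_mul, ENNReal.ofReal_add hε.le hε.le]
    exact add_le_add hA₁P hA₂P
  · rintro x ⟨⟨hx₀, hx₁⟩, hx₂⟩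
    refine ⟨hA₀r x hx₀, fun θ hθ => ⟨?_, fun hδ1 => ?_⟩⟩
    -- With c = -λ, oddness of ψ turns the upper bound into a lower bound on the estimating sum.
    · have h1 := hA₁b x hx₁ (hA₀r x hx₀) θ (energy P θ / (1 + deltaHat d n κ ε)) hθ (by positivity)
      have ht : energy P θ / (energy P θ / (1 + deltaHat d n κ ε)) = 1 + deltaHat d n κ ε := by
        field_simp
      simp_rw [neg_mul, psi_neg, ht] at h1
      rw [Finset.sum_neg_distrib] at h1
      have h2 := mul_neg_of_pos_of_neg (mul_pos hn hscale) (lower_level_neg hκ hL hs)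
      linarith
    · have hδ' : 0 < 1 - deltaHat d n κ ε := sub_pos.2 hδ1
      have h1 := hA₂b x hx₂ (hA₀r x hx₀) θ (energy P θ / (1 - deltaHat d n κ ε)) hθ (by positivity)
      have ht : energy P θ / (energy P θ / (1 - deltaHat d n κ ε)) = 1 - deltaHat d n κ ε := by
        field_simp
      rw [ht] at h1
      have h2 := mul_nonpos_of_nonneg_of_nonpos (mul_pos hn hscale).le
        (upper_level_nonpos hκ hL hs hδ1)
      linarith

end DeviationEvent

/-! ### The robust estimator as a root, and its comparison with the empirical energy -/

section RobustEnergy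

variable {d n : ℕ} {lam : ℝ} {x : Fin n → EuclideanSpace ℝ (Fin d)} {θ : EuclideanSpace ℝ (Fin d)}

/-- The estimating function defining the robust estimator. -/
noncomputable def estimatingSum (lam : ℝ) (x : Fin n → EuclideanSpace ℝ (Fin d))
    (θ : EuclideanSpace ℝ (Fin d)) (ρ : ℝ) : ℝ :=
  ∑ i, psi (lam * (ρ⁻¹ * ⟪θ, x i⟫ ^ 2 - 1))

theorem estimatingSum_antitone (hlam : 0 ≤ lam) {ρ ρ' : ℝ} (hρ : 0 < ρ) (h : ρ ≤ ρ') :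
    estimatingSum lam x θ ρ' ≤ estimatingSum lam x θ ρ := by
  refine Finset.sum_le_sum fun i _ => psi_mono ?_
  gcongr

theorem continuousAt_estimatingSum {ρ : ℝ} (hρ : ρ ≠ 0) :
    ContinuousAt (estimatingSum lam x θ) ρ := by
  unfold estimatingSum
  refine tendsto_finsetSum _ fun i _ => ?_
  have h1 : ContinuousAt (fun ρ : ℝ => lam * (ρ⁻¹ * ⟪θ, x i⟫ ^ 2 - 1)) ρ := by
    have := continuousAt_inv₀ hρ
    fun_prop
  exact continuous_psi.continuousAt.comp h1

theorem bddBelow_estimatingSet :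
    BddBelow {ρ : ℝ | 0 < ρ ∧ estimatingSum lam x θ ρ ≤ 0} := ⟨0, fun _ h => h.1.le⟩

theorem psi_nonpos {z : ℝ} (hz : z ≤ 0) : psi z ≤ 0 := psi_zero ▸ psi_mono hz

theorem nonempty_estimatingSet (hlam : 0 ≤ lam) :
    {ρ : ℝ | 0 < ρ ∧ estimatingSum lam x θ ρ ≤ 0}.Nonempty := by
  have h0 : 0 ≤ ∑ i, ⟪θ, x i⟫ ^ 2 := Finset.sum_nonneg fun i _ => sq_nonneg _
  -- At this ρ every argument of ψ is nonpositive; the 1 keeps ρ positive when all inner products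
  -- vanish.
  refine ⟨∑ i, ⟪θ, x i⟫ ^ 2 + 1, by positivity, Finset.sum_nonpos fun i _ => psi_nonpos ?_⟩
  have h1 : ⟪θ, x i⟫ ^ 2 ≤ ∑ i, ⟪θ, x i⟫ ^ 2 :=
    Finset.single_le_sum (f := fun i => ⟪θ, x i⟫ ^ 2) (fun i _ => sq_nonneg _) (Finset.mem_univ i)
  refine mul_nonpos_of_nonneg_of_nonpos hlam ?_
  rw [sub_nonpos, inv_mul_le_iff₀ (by positivity)]
  linarith

theorem robustEnergy_le {ρ : ℝ} (hρ : 0 < ρ) (h : estimatingSum lam x θ ρ ≤ 0) :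
    robustEnergy lam x θ ≤ ρ := csInf_le bddBelow_estimatingSet ⟨hρ, h⟩

theorem le_robustEnergy (hlam : 0 ≤ lam) {ρ : ℝ} (h : 0 < estimatingSum lam x θ ρ) :
    ρ ≤ robustEnergy lam x θ := by
  refine le_csInf (nonempty_estimatingSet hlam) fun r hr => ?_
  by_contra! hlt
  exact absurd ((estimatingSum_antitone hlam hr.1 hlt.le).trans hr.2) (not_le.2 h)

theorem robustEnergy_eq_zero (hlam : 0 ≤ lam) (h : ∀ i, ⟪θ, x i⟫ = 0) :
    robustEnergy lam x θ = 0 := by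
  have hle : ∀ ρ : ℝ, 0 < ρ → robustEnergy lam x θ ≤ ρ := fun ρ hρ => by
    refine robustEnergy_le hρ (Finset.sum_nonpos fun i _ => psi_nonpos ?_)
    rw [h i]
    simpa using hlam
  refine le_antisymm (le_of_forall_gt_imp_ge_of_dense hle) ?_
  exact Real.sInf_nonneg fun ρ hρ => hρ.1.le

/-- The sum is nonpositive to the right of the infimum and positive to its left; continuity at the
infimum, where ρ ≠ 0, forces a zero. -/
theorem estimatingSum_robustEnergy (hlam : 0 ≤ lam) (h : 0 < robustEnergy lam x θ) :
    estimatingSum lam x θ (robustEnergy lam x θ) = 0 := by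
  have hc := continuousAt_estimatingSum (lam := lam) (x := x) (θ := θ) h.ne'
  refine le_antisymm ?_ ?_
  · refine le_of_tendsto (hc.tendsto.mono_left (nhdsWithin_le_nhds (s := Set.Ioi (robustEnergy lam x θ)))) ?_
    filter_upwards [self_mem_nhdsWithin] with ρ hρ
    obtain ⟨r, hr, hrρ⟩ := exists_lt_of_csInf_lt (nonempty_estimatingSet hlam) hρ
    exact (estimatingSum_antitone hlam hr.1 hrρ.le).trans hr.2
  · refine ge_of_tendsto (hc.tendsto.mono_left (nhdsWithin_le_nhds (s := Set.Iio (robustEnergy lam x θ)))) ?_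
    filter_upwards [self_mem_nhdsWithin, nhdsWithin_le_nhds (lt_mem_nhds h)] with ρ hρ hρ0
    by_contra! hlt
    exact absurd (robustEnergy_le hρ0 hlt.le) (not_le.2 hρ)

theorem empEnergy_eq : empEnergy x θ = (n : ℝ)⁻¹ * ∑ i, ⟪θ, x i⟫ ^ 2 := by
  unfold empEnergy empGram
  rw [Matrix.smul_mulVec, dotProduct_smul, Matrix.sum_mulVec, dotProduct_sum, smul_eq_mul]
  congr 1
  refine Finset.sum_congr rfl fun i _ => ?_
  have h : ⟪θ, x i⟫ = (x i).ofLp ⬝ᵥ θ.ofLp := by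
    simp [PiLp.inner_apply, dotProduct]
  have h' : ⟪θ, x i⟫ = θ.ofLp ⬝ᵥ (x i).ofLp := by rw [h, dotProduct_comm]
  rw [Matrix.vecMulVec_mulVec, dotProduct_smul, ← h, ← h']
  simp [sq]

theorem empEnergy_nonneg : 0 ≤ empEnergy x θ := by
  rw [empEnergy_eq]
  exact mul_nonneg (by positivity) (Finset.sum_nonneg fun i _ => sq_nonneg _)

/-- The cubic lower bound on ψ is summed at the root and divided by nλ. -/
theorem empEnergy_div_sub_one_le (hn : (0 : ℝ) < n) (hlam : 0 < lam)
    (h : 0 < robustEnergy lam x θ) :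
    empEnergy x θ / robustEnergy lam x θ - 1 ≤
      lam ^ 2 / 3 * ((n : ℝ)⁻¹ * ∑ i, max (⟪θ, x i⟫ ^ 2 / robustEnergy lam x θ - 1) 0 ^ 3) := by
  set r := robustEnergy lam x θ with hr
  have h1 : ∑ i, (lam * (⟪θ, x i⟫ ^ 2 / r - 1) -
      lam ^ 3 * max (⟪θ, x i⟫ ^ 2 / r - 1) 0 ^ 3 / 3) ≤ 0 := by
    refine le_of_le_of_eq (Finset.sum_le_sum fun i _ => ?_) (estimatingSum_robustEnergy hlam.le h)
    rw [← hr, inv_mul_eq_div]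
    refine le_trans (le_of_eq ?_) (sub_cube_posPart_le_psi _)
    rw [← mul_pow, mul_max_of_nonneg _ _ hlam.le, mul_zero]
  rw [empEnergy_eq]
  have h2 : ∑ i, (lam * (⟪θ, x i⟫ ^ 2 / r - 1) -
      lam ^ 3 * max (⟪θ, x i⟫ ^ 2 / r - 1) 0 ^ 3 / 3) =
      n * lam * ((n : ℝ)⁻¹ * (∑ i, ⟪θ, x i⟫ ^ 2) / r - 1 -
        lam ^ 2 / 3 * ((n : ℝ)⁻¹ * ∑ i, max (⟪θ, x i⟫ ^ 2 / r - 1) 0 ^ 3)) := by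
    rw [Finset.sum_sub_distrib, ← Finset.mul_sum, Finset.sum_sub_distrib, ← Finset.sum_div,
      ← Finset.sum_div, ← Finset.mul_sum]
    simp
    field_simp
  rw [h2] at h1
  have := nonpos_of_mul_nonpos_right h1 (by positivity)
  linarith

theorem one_sub_empEnergy_div_le (hn : (0 : ℝ) < n) (hlam : 0 < lam)
    (h : 0 < robustEnergy lam x θ) :
    1 - empEnergy x θ / robustEnergy lam x θ ≤
      lam ^ 2 / 3 * ((n : ℝ)⁻¹ * ∑ i, max (1 - ⟪θ, x i⟫ ^ 2 / robustEnergy lam x θ) 0 ^ 3) := by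
  set r := robustEnergy lam x θ with hr
  have h1 : 0 ≤ ∑ i, (lam * (⟪θ, x i⟫ ^ 2 / r - 1) +
      lam ^ 3 * max (1 - ⟪θ, x i⟫ ^ 2 / r) 0 ^ 3 / 3) := by
    refine le_of_eq_of_le (estimatingSum_robustEnergy hlam.le h).symm
      (Finset.sum_le_sum fun i _ => ?_)
    rw [← hr, inv_mul_eq_div]
    refine (psi_le_add_cube_negPart _).trans (le_of_eq ?_)
    rw [← mul_pow, mul_max_of_nonneg _ _ hlam.le, mul_zero]
    congr 4
    ring
  rw [empEnergy_eq]
  have h2 : ∑ i, (lam * (⟪θ, x i⟫ ^ 2 / r - 1) +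
      lam ^ 3 * max (1 - ⟪θ, x i⟫ ^ 2 / r) 0 ^ 3 / 3) =
      n * lam * ((n : ℝ)⁻¹ * (∑ i, ⟪θ, x i⟫ ^ 2) / r - 1 +
        lam ^ 2 / 3 * ((n : ℝ)⁻¹ * ∑ i, max (1 - ⟪θ, x i⟫ ^ 2 / r) 0 ^ 3)) := by
    rw [Finset.sum_add_distrib, ← Finset.mul_sum, Finset.sum_sub_distrib, ← Finset.sum_div,
      ← Finset.sum_div, ← Finset.mul_sum]
    simp
    field_simp
  rw [h2] at h1
  have := nonneg_of_mul_nonneg_right h1 (by positivity)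
  linarith

end RobustEnergy

/-! ### The chain of inequalities with extended-real quotients -/

section ExtendedReals

theorem EReal_coe_sum {ι : Type*} (s : Finset ι) (f : ι → ℝ) :
    ((∑ i ∈ s, f i : ℝ) : EReal) = ∑ i ∈ s, (f i : EReal) := by
  classical
  induction s using Finset.induction_on with
  | empty => simp
  | insert a s ha ih => rw [Finset.sum_insert ha, Finset.sum_insert ha, EReal.coe_add, ih]

theorem EReal_coe_max (a b : ℝ) : ((max a b : ℝ) : EReal) = max (a : EReal) (b : EReal) :=
  EReal.coe_strictMono.monotone.map_max

theorem ratio_coe {a b : ℝ} (hb : b ≠ 0) : ratio (a : EReal) (b : EReal) = ((a / b : ℝ) : EReal) := by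
  rw [ratio, if_neg (by exact_mod_cast hb), EReal.coe_div]

theorem ratio_zero_zero : ratio 0 0 = 1 := by simp [ratio]

theorem ratio_zero {a : EReal} (ha : a ≠ 0) : ratio a 0 = ⊤ := by simp [ratio, ha]

/-- Here q stands for N̄/N and r for N̄/N̂. From r - 1 ≤ dp ≤ γp r one gets r(1-γp) ≤ 1, then
dp(1-γp) ≤ γp, that is, 1 + dp ≤ 1/(1-γp) when γp < 1. Where a positive part vanishes the numerator
is positive, because δ > 0, and the quotient is ⊤. -/
theorem ratio_chain {δ γm γp dp dm q r : ℝ} (hδ : 0 < δ) (hγp : 0 ≤ γp) (hdp0 : 0 ≤ dp)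
    (hdm : 1 - r ≤ dm) (hdp : r - 1 ≤ dp) (hdmγ : dm ≤ γm)
    (hdpγ : dp ≤ γp * r) (hlow : r ≤ q * (1 + δ)) (hup : δ < 1 → q * (1 - δ) ≤ r) :
    -(((δ + γm) / (1 + δ) : ℝ) : EReal) ≤ -(((δ : EReal) + (dm : EReal)) / ((1 + δ : ℝ) : EReal)) ∧
    -(((δ : EReal) + (dm : EReal)) / ((1 + δ : ℝ) : EReal)) ≤ (q : EReal) - 1 ∧
    (q : EReal) - 1 ≤ ratio ((δ : EReal) + (dp : EReal)) ((max (1 - δ) 0 : ℝ) : EReal) ∧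
    ratio ((δ : EReal) + (dp : EReal)) ((max (1 - δ) 0 : ℝ) : EReal) ≤
      ratio 1 ((max (1 - δ) 0 * max (1 - γp) 0 : ℝ) : EReal) - 1 ∧
    ratio 1 ((max (1 - δ) 0 * max (1 - γp) 0 : ℝ) : EReal) - 1 ≤
      ratio ((δ + γp : ℝ) : EReal) ((max (1 - δ) 0 * max (1 - γp) 0 : ℝ) : EReal) := by
  have hδ1 : 0 < 1 + δ := by linarith
  have e1 : -(((δ : EReal) + (dm : EReal)) / ((1 + δ : ℝ) : EReal)) =
      ((-((δ + dm) / (1 + δ)) : ℝ) : EReal) := by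
    rw [← EReal.coe_add, ← EReal.coe_div, ← EReal.coe_neg]
  have e2 : (q : EReal) - 1 = ((q - 1 : ℝ) : EReal) := by
    rw [EReal.coe_sub, EReal.coe_one]
  have e3 : (δ : EReal) + (dp : EReal) = ((δ + dp : ℝ) : EReal) := (EReal.coe_add _ _).symm
  have e4 : (1 : EReal) = ((1 : ℝ) : EReal) := EReal.coe_one.symm
  have htop : (⊤ : EReal) - 1 = ⊤ := by rw [e4]; exact EReal.top_sub_coe 1
  refine ⟨?_, ?_, ?_⟩
  · rw [e1, ← EReal.coe_neg, EReal.coe_le_coe_iff, neg_le_neg_iff]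
    gcongr
  · rw [e1, e2, EReal.coe_le_coe_iff, neg_le_iff_add_nonneg, ← sub_nonneg]
    have : q - 1 + (δ + dm) / (1 + δ) - 0 = (q * (1 + δ) - (1 - dm)) / (1 + δ) := by
      field_simp; ring
    rw [this]
    exact div_nonneg (by linarith) hδ1.le
  · rw [e3]
    rcases le_or_gt 1 δ with h1 | h1
    · rw [max_eq_right (by linarith : 1 - δ ≤ 0), zero_mul, EReal.coe_zero,
        ratio_zero (by exact_mod_cast (by positivity : δ + dp ≠ 0)), ratio_zero one_ne_zero,
        ratio_zero (by exact_mod_cast (by positivity : δ + γp ≠ 0)), htop]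
      exact ⟨le_top, le_rfl, le_rfl⟩
    · have h1' : 0 < 1 - δ := sub_pos.2 h1
      rw [max_eq_left h1'.le, ratio_coe h1'.ne', e2]
      refine ⟨?_, ?_⟩
      · rw [EReal.coe_le_coe_iff, le_div_iff₀ h1']
        have := hup h1
        linarith
      · rcases le_or_gt 1 γp with h2 | h2
        · rw [max_eq_right (by linarith : 1 - γp ≤ 0), mul_zero, EReal.coe_zero,
            ratio_zero one_ne_zero,
            ratio_zero (by exact_mod_cast (by positivity : δ + γp ≠ 0)), htop]
          exact ⟨le_top, le_rfl⟩
        · have h2' : 0 < 1 - γp := sub_pos.2 h2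
          have h3 : 0 < (1 - δ) * (1 - γp) := mul_pos h1' h2'
          have h4 : ratio 1 (((1 - δ) * (1 - γp) : ℝ) : EReal) - 1 =
              ((1 / ((1 - δ) * (1 - γp)) - 1 : ℝ) : EReal) := by
            rw [EReal.coe_sub, ← ratio_coe h3.ne', EReal.coe_one]
          rw [max_eq_left h2'.le, ratio_coe h3.ne', h4, EReal.coe_le_coe_iff, EReal.coe_le_coe_iff]
          have hr : r * (1 - γp) ≤ 1 := by linarith
          have hdp' : dp * (1 - γp) ≤ γp := by
            have := mul_le_mul_of_nonneg_left hr hγp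
            have := mul_le_mul_of_nonneg_right hdpγ h2'.le
            linarith
          constructor
          · rw [le_sub_iff_add_le, div_add_one h1'.ne', div_le_div_iff₀ h1' h3]
            nlinarith
          · rw [sub_le_iff_le_add, div_add_one h3.ne']
            gcongr
            nlinarith

end ExtendedReals

/-! ### Bounds on δ̄₊ and δ̄₋, and the deterministic deviation bounds -/

section UniformBounds

variable {d n : ℕ} {P : Measure (EuclideanSpace ℝ (Fin d))} {κ ε : ℝ}
  {x : Fin n → EuclideanSpace ℝ (Fin d)} {θ : EuclideanSpace ℝ (Fin d)}

theorem cubic_coeff_eq (hκ : 1 < κ) (hL : 0 ≤ confTerm d ε) :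
    2 * confTerm d ε / (3 * (κ - 1) * n) = scale d n κ ε ^ 2 / 3 := by
  rw [scale_sq hκ hL]
  field_simp

theorem gammaMinus_eq (hκ : 1 < κ) (hL : 0 ≤ confTerm d ε) :
    gammaMinus d n κ ε = scale d n κ ε ^ 2 / 3 := cubic_coeff_eq hκ hL

theorem gammaPlus_eq (hκ : 1 < κ) (hL : 0 ≤ confTerm d ε) :
    gammaPlus P κ ε x =
      scale d n κ ε ^ 2 / 3 * (sampleRadius P x ^ 2 * (1 + deltaHat d n κ ε)) ^ 2 := by
  rw [← cubic_coeff_eq hκ hL, gammaPlus]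
  ring

theorem deltaBarPlus_eq_coe (hκ : 1 < κ) (hL : 0 ≤ confTerm d ε)
    (h : 0 < robustEnergy (scale d n κ ε) x θ) :
    deltaBarPlus κ ε x θ = ((scale d n κ ε ^ 2 / 3 * ((n : ℝ)⁻¹ *
      ∑ i, max (⟪θ, x i⟫ ^ 2 / robustEnergy (scale d n κ ε) x θ - 1) 0 ^ 3) : ℝ) : EReal) := by
  simp only [deltaBarPlus, ratio_coe h.ne']
  simp only [← cubic_coeff_eq hκ hL, EReal.coe_mul, EReal_coe_sum,
    EReal.coe_pow, EReal_coe_max, EReal.coe_sub, EReal.coe_one, EReal.coe_zero]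

theorem deltaBarMinus_eq_coe (hκ : 1 < κ) (hL : 0 ≤ confTerm d ε)
    (h : 0 < robustEnergy (scale d n κ ε) x θ) :
    deltaBarMinus κ ε x θ = ((scale d n κ ε ^ 2 / 3 * ((n : ℝ)⁻¹ *
      ∑ i, max (1 - ⟪θ, x i⟫ ^ 2 / robustEnergy (scale d n κ ε) x θ) 0 ^ 3) : ℝ) : EReal) := by
  simp only [deltaBarMinus, ratio_coe h.ne']
  simp only [← cubic_coeff_eq hκ hL, EReal.coe_mul, EReal_coe_sum,
    EReal.coe_pow, EReal_coe_max, EReal.coe_sub, EReal.coe_one, EReal.coe_zero]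

theorem one_sub_one_EReal : (1 : EReal) - 1 = 0 := by
  rw [← EReal.coe_one, ← EReal.coe_sub, sub_self, EReal.coe_zero]

theorem deltaBarPlus_eq_zero (h : ∀ i, ⟪θ, x i⟫ = 0) : deltaBarPlus κ ε x θ = 0 := by
  simp [deltaBarPlus, h, robustEnergy_eq_zero (scale_nonneg (d := d) (n := n) (κ := κ) (ε := ε)) h,
    ratio_zero_zero, one_sub_one_EReal]

theorem deltaBarMinus_eq_zero (h : ∀ i, ⟪θ, x i⟫ = 0) : deltaBarMinus κ ε x θ = 0 := by
  simp [deltaBarMinus, h, robustEnergy_eq_zero (scale_nonneg (d := d) (n := n) (κ := κ) (ε := ε)) h,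
    ratio_zero_zero, one_sub_one_EReal]

/-- Cauchy–Schwarz in whitened coordinates. -/
theorem inner_sq_le_sampleRadius (hP : MemLp id 2 P) (hx : IsRegularSample P x) (i : Fin n) :
    ⟪θ, x i⟫ ^ 2 ≤ energy P θ * sampleRadius P x ^ 2 := by
  have h1 : ‖whiten P (x i)‖ ≤ sampleRadius P x :=
    le_ciSup (f := fun i => ‖whiten P (x i)‖) (Set.finite_range _).bddAbove i
  rw [← inner_colour_whiten (hx i), ← norm_colour_sq hP, ← mul_pow, ← sq_abs]
  have h2 := abs_real_inner_le_norm (colour P θ) (whiten P (x i))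
  have h3 := mul_le_mul_of_nonneg_left h1 (norm_nonneg (colour P θ))
  gcongr
  linarith

/-- One factor u is kept so that summation over the sample reproduces N̄/N̂; the other two are
bounded by B, which will be R²(1+δ̂). -/
theorem max_sub_one_pow_three_le {u B : ℝ} (hu : 0 ≤ u) (huB : u ≤ B) :
    max (u - 1) 0 ^ 3 ≤ u * B ^ 2 := by
  rcases le_total u 1 with h | h
  · rw [max_eq_right (by linarith)]
    simp only [ne_eq, OfNat.ofNat_ne_zero, not_false_eq_true, zero_pow]
    positivity
  · rw [max_eq_left (by linarith)]
    calc (u - 1) ^ 3 ≤ u ^ 3 := by gcongr; linarith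
      _ = u * u ^ 2 := by ring
      _ ≤ u * B ^ 2 := by gcongr

/-- The deterministic part of the deviation bounds: they hold as soon as the estimating equation
changes sign between `N / (1 + δ)` and `N / (1 - δ)`. -/
theorem deviation_bounds (hP : MemLp id 2 P) (hκ : 1 < κ) (hL : 0 < confTerm d ε)
    (hs : SampleSizeCondition d n κ ε) (hx : IsRegularSample P x)
    (hlow : 0 < energy P θ → 0 < estimatingSum (scale d n κ ε) x θ
      (energy P θ / (1 + deltaHat d n κ ε)))
    (hup : 0 < energy P θ → deltaHat d n κ ε < 1 → estimatingSum (scale d n κ ε) x θ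
      (energy P θ / (1 - deltaHat d n κ ε)) ≤ 0) :
    ∃ dp dm q r : ℝ, deltaBarPlus κ ε x θ = dp ∧ deltaBarMinus κ ε x θ = dm ∧
      ratio (empEnergy x θ : EReal) (energy P θ : EReal) = q ∧
      ratio (empEnergy x θ : EReal) (robustEnergy (scale d n κ ε) x θ : EReal) = r ∧
      0 ≤ dp ∧ 1 - r ≤ dm ∧ r - 1 ≤ dp ∧ dm ≤ gammaMinus d n κ ε ∧
      dp ≤ gammaPlus P κ ε x * r ∧ r ≤ q * (1 + deltaHat d n κ ε) ∧
      (deltaHat d n κ ε < 1 → q * (1 - deltaHat d n κ ε) ≤ r) := by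
  have hn := cast_pos_of_sampleSizeCondition hs
  have hδ := deltaHat_pos hκ hL hs
  have hscale := scale_pos hκ hL hn
  rw [gammaMinus_eq hκ hL.le, gammaPlus_eq hκ hL.le]
  -- If N(θ) = 0, the sample is orthogonal to θ, so N̄ = N̂ = 0 and both quotients are 0/0 = 1.
  rcases (energy_nonneg (P := P) θ).eq_or_lt with hE | hE
  · have hz : ∀ i, ⟪θ, x i⟫ = 0 := fun i => by
      have := inner_sq_le_sampleRadius (θ := θ) hP hx i
      rw [← hE, zero_mul] at this
      exact pow_eq_zero_iff two_ne_zero |>.1 (le_antisymm this (sq_nonneg _))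
    have hemp : empEnergy x θ = 0 := by simp [empEnergy_eq, hz]
    refine ⟨0, 0, 1, 1, ?_, ?_, ?_, ?_, le_rfl, by simp, by simp, by positivity, by positivity,
      by linarith, fun _ => by linarith⟩
    · rw [deltaBarPlus_eq_zero hz, EReal.coe_zero]
    · rw [deltaBarMinus_eq_zero hz, EReal.coe_zero]
    · rw [hemp, ← hE, EReal.coe_zero, ratio_zero_zero, EReal.coe_one]
    · rw [hemp, robustEnergy_eq_zero hscale.le hz, EReal.coe_zero, ratio_zero_zero, EReal.coe_one]
  · have hle := le_robustEnergy hscale.le (hlow hE)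
    have hr : 0 < robustEnergy (scale d n κ ε) x θ := lt_of_lt_of_le (by positivity) hle
    have hge : deltaHat d n κ ε < 1 → robustEnergy (scale d n κ ε) x θ ≤
        energy P θ / (1 - deltaHat d n κ ε) := fun h1 =>
      robustEnergy_le (div_pos hE (sub_pos.2 h1)) (hup hE h1)
    refine ⟨_, _, _, _, deltaBarPlus_eq_coe hκ hL.le hr, deltaBarMinus_eq_coe hκ hL.le hr,
      ratio_coe hE.ne', ratio_coe hr.ne', by positivity, one_sub_empEnergy_div_le hn hscale hr,
      empEnergy_div_sub_one_le hn hscale hr, ?_, ?_, ?_, fun h1 => ?_⟩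
    · refine mul_le_of_le_one_right (by positivity) ?_
      rw [inv_mul_le_iff₀ hn, mul_one]
      calc ∑ i, max (1 - ⟪θ, x i⟫ ^ 2 / robustEnergy (scale d n κ ε) x θ) 0 ^ 3
          ≤ ∑ _i : Fin n, (1 : ℝ) := by
            refine Finset.sum_le_sum fun i _ => pow_le_one₀ (le_max_right _ _) ?_
            refine max_le ?_ zero_le_one
            have : 0 ≤ ⟪θ, x i⟫ ^ 2 / robustEnergy (scale d n κ ε) x θ := by positivity
            linarith
        _ = n := by simp
    · rw [mul_assoc]
      refine mul_le_mul_of_nonneg_left ?_ (by positivity)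
      rw [empEnergy_eq, mul_div_assoc, mul_left_comm]
      refine mul_le_mul_of_nonneg_left ?_ (by positivity)
      rw [Finset.sum_div, Finset.mul_sum]
      refine Finset.sum_le_sum fun i _ => ?_
      rw [mul_comm]
      refine max_sub_one_pow_three_le (by positivity) ?_
      rw [div_le_iff₀ hr]
      rw [div_le_iff₀ (by positivity)] at hle
      have h1 := inner_sq_le_sampleRadius (θ := θ) hP hx i
      have h2 := mul_le_mul_of_nonneg_right hle (sq_nonneg (sampleRadius P x))
      linarith
    · rw [div_le_iff₀ (by positivity)] at hle
      rw [div_mul_eq_mul_div, div_le_div_iff₀ hr hE, mul_assoc, mul_comm (1 + _)]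
      exact mul_le_mul_of_nonneg_left hle empEnergy_nonneg
    · have h2 := hge h1
      rw [le_div_iff₀ (sub_pos.2 h1)] at h2
      rw [div_mul_eq_mul_div, div_le_div_iff₀ hE hr, mul_assoc, mul_comm (1 - _)]
      exact mul_le_mul_of_nonneg_left h2 empEnergy_nonneg

end UniformBounds

/-! ### Orders of magnitude of δ̂ and of the lower bound -/

section OrdersOfMagnitude

variable {d n : ℕ} {κ ε : ℝ}

theorem mu_le_deltaHat (hκ : 1 < κ) (hs : SampleSizeCondition d n κ ε) :
    mu d n κ ε ≤ deltaHat d n κ ε := by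
  have h1 := deltaHat_eq hκ hs
  have h2 := mu_nonneg (d := d) (n := n) (κ := κ) (ε := ε)
  have h3 : 0 ≤ deltaHat d n κ ε := div_nonneg h2 (one_sub_two_mul_mu_pos hκ hs).le
  have := mul_nonneg h2 h3
  linarith

/-- The sample size condition gives λ ≤ 2, and (κ-1)λ ≤ μ ≤ δ̂; hence (κ-1)γ₋ = (κ-1)λ²/3 ≤ (2/3)δ̂.
-/
theorem lower_bound_order (hκ : 1 < κ) (hL : 0 ≤ confTerm d ε)
    (hs : SampleSizeCondition d n κ ε) :
    (deltaHat d n κ ε + gammaMinus d n κ ε) / (1 + deltaHat d n κ ε) ≤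
      2 * (κ / (κ - 1)) * deltaHat d n κ ε := by
  have hκ' : 0 < κ - 1 := sub_pos.2 hκ
  have hμ := mu_nonneg (d := d) (n := n) (κ := κ) (ε := ε)
  have hμδ := mu_le_deltaHat hκ hs
  have hδ : 0 ≤ deltaHat d n κ ε := hμ.trans hμδ
  have hl := scale_nonneg (d := d) (n := n) (κ := κ) (ε := ε)
  have hc := Real.sqrt_nonneg (κ * d / n)
  have hb := sampleSize_bound hκ hs
  have hl2 : scale d n κ ε ≤ 2 := by
    have := mul_nonneg hκ'.le hl
    linarith
  have hlδ : (κ - 1) * scale d n κ ε ≤ deltaHat d n κ ε := by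
    refine le_trans ?_ hμδ
    rw [mu_eq hκ]
    have : 0 ≤ 6.81 * √2 * √(κ * d / n) := by positivity
    linarith
  have hγ : 0 ≤ gammaMinus d n κ ε := by rw [gammaMinus_eq hκ hL]; positivity
  calc (deltaHat d n κ ε + gammaMinus d n κ ε) / (1 + deltaHat d n κ ε)
      ≤ deltaHat d n κ ε + gammaMinus d n κ ε := div_le_self (by positivity) (by linarith)
    _ ≤ 2 * (κ / (κ - 1)) * deltaHat d n κ ε := by
        rw [gammaMinus_eq hκ hL, mul_div_assoc', div_mul_eq_mul_div, le_div_iff₀ hκ']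
        have h1 : scale d n κ ε ^ 2 / 3 * (κ - 1) ≤ 2 / 3 * deltaHat d n κ ε := by
          nlinarith
        nlinarith

theorem deltaHat_order (hκ : 1 < κ) (hε : 0 < ε) (hε1 : ε ≤ 1)
    (hs : SampleSizeCondition d n κ ε) :
    deltaHat d n κ ε ≤ 400 * √(κ * (d + Real.log ε⁻¹) / n) := by
  have hn := cast_pos_of_sampleSizeCondition hs
  have hκ' : 0 < κ - 1 := sub_pos.2 hκ
  have hlog : 0 ≤ Real.log ε⁻¹ := Real.log_nonneg ((one_le_inv₀ hε).2 hε1)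
  have hμ := mu_nonneg (d := d) (n := n) (κ := κ) (ε := ε)
  have hl := scale_nonneg (d := d) (n := n) (κ := κ) (ε := ε)
  have hb := sampleSize_bound hκ hs
  have h2 : √2 < 1.41422 := by
    rw [Real.sqrt_lt' (by norm_num)]; norm_num
  have hc : √(κ * d / n) ≤ √(κ * (d + Real.log ε⁻¹) / n) := by
    gcongr; linarith
  have hσ : (κ - 1) * scale d n κ ε ≤ √2 * √(κ * (d + Real.log ε⁻¹) / n) := by
    rw [sub_one_mul_scale hκ, ← Real.sqrt_mul zero_le_two]
    refine Real.sqrt_le_sqrt ?_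
    have hd : (0 : ℝ) ≤ d := Nat.cast_nonneg d
    have hL : 0 ≤ confTerm d ε := by unfold confTerm; positivity
    have h3 : confTerm d ε ≤ d + Real.log ε⁻¹ := by unfold confTerm; linarith
    calc 2 * (κ - 1) / n * confTerm d ε ≤ 2 * κ / n * (d + Real.log ε⁻¹) := by
          gcongr
          linarith
      _ = 2 * (κ * (d + Real.log ε⁻¹) / n) := by ring
  have hc0 := Real.sqrt_nonneg (κ * d / n)
  have hr0 := Real.sqrt_nonneg (κ * (d + Real.log ε⁻¹) / n)
  have hσ0 : 0 ≤ (κ - 1) * scale d n κ ε := by positivity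
  -- 6.81 · 1.41422/20 < 0.482 by the sample size condition. Thus 1 - 2μ ≥ 0.036, and 12/0.036 <
  -- 400.
  have hμle : mu d n κ ε ≤ 0.482 := by
    rw [mu_eq hκ]
    have : 6.81 * √2 * √(κ * d / n) ≤ 6.81 * 1.41422 * √(κ * d / n) := by gcongr
    linarith
  have hμle' : mu d n κ ε ≤ 12 * √(κ * (d + Real.log ε⁻¹) / n) := by
    rw [mu_eq hκ]
    have h4 : 6.81 * √2 * √(κ * d / n) ≤
        6.81 * 1.41422 * √(κ * (d + Real.log ε⁻¹) / n) := by gcongr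
    have h5 : √2 * √(κ * (d + Real.log ε⁻¹) / n) ≤
        1.41422 * √(κ * (d + Real.log ε⁻¹) / n) := by gcongr
    linarith
  unfold deltaHat
  rw [div_le_iff₀ (by linarith)]
  nlinarith

end OrdersOfMagnitude

/-! ### Transfer to the underlying probability space and conclusion -/

theorem exists_measurableSet_preimage {Ω α : Type*} [MeasurableSpace Ω] [MeasurableSpace α]
    {Pr : Measure Ω} {Z : Ω → α} (hZ : AEMeasurable Z Pr) {A : Set α} (hA : MeasurableSet A) :
    ∃ B : Set Ω, MeasurableSet B ∧ B ⊆ Z ⁻¹' A ∧ Pr B = Pr.map Z A := by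
  obtain ⟨B, hBA, hB, hae⟩ :=
    (hZ.nullMeasurableSet_preimage hA).exists_measurable_subset_ae_eq
  exact ⟨B, hB, hBA, by rw [measure_congr hae, Measure.map_apply_of_aemeasurable hZ hA]⟩

end GramEstimation

theorem proposition3p1 :
    -- the deviation bounds, uniform in `θ`, with probability at least `1 - 2ε`;
    -- a bound with a vanishing denominator is `+∞`
    (∀ {Ω : Type*} [MeasurableSpace Ω] (Pr : Measure Ω) [IsProbabilityMeasure Pr] (d n : ℕ)
        (P : Measure (EuclideanSpace ℝ (Fin d))) [IsProbabilityMeasure P]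
        (X : Fin n → Ω → EuclideanSpace ℝ (Fin d)) (κ ε : ℝ),
      (∀ i, HasLaw (X i) P Pr) → iIndepFun X Pr →
      MemLp id 2 P → 1 < κ → kurtosis P ≤ ENNReal.ofReal κ →
      0 < ε → SampleSizeCondition d n κ ε →
      ∃ B : Set Ω, MeasurableSet B ∧ 1 - 2 * ε ≤ Pr.real B ∧
        ∀ ω ∈ B, ∀ θ : EuclideanSpace ℝ (Fin d),
          let x : Fin n → EuclideanSpace ℝ (Fin d) := fun i => X i ω
          let δ : ℝ := deltaHat d n κ ε
          let γm : ℝ := gammaMinus d n κ ε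
          let γp : ℝ := gammaPlus P κ ε x
          let Dp : EReal := deltaBarPlus κ ε x θ
          let Dm : EReal := deltaBarMinus κ ε x θ
          let q : EReal := ratio (empEnergy x θ : EReal) (energy P θ : EReal)
          Dp ≤ (γp : EReal) *
              ratio (empEnergy x θ : EReal) (robustEnergy (scale d n κ ε) x θ : EReal) ∧
          Dm ≤ (γm : EReal) ∧
          -(((δ + γm) / (1 + δ) : ℝ) : EReal) ≤ -(((δ : EReal) + Dm) / ((1 + δ : ℝ) : EReal)) ∧
          -(((δ : EReal) + Dm) / ((1 + δ : ℝ) : EReal)) ≤ q - 1 ∧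
          q - 1 ≤ ratio ((δ : EReal) + Dp) ((max (1 - δ) 0 : ℝ) : EReal) ∧
          ratio ((δ : EReal) + Dp) ((max (1 - δ) 0 : ℝ) : EReal) ≤
            ratio 1 ((max (1 - δ) 0 * max (1 - γp) 0 : ℝ) : EReal) - 1 ∧
          ratio 1 ((max (1 - δ) 0 * max (1 - γp) 0 : ℝ) : EReal) - 1 ≤
            ratio ((δ + γp : ℝ) : EReal) ((max (1 - δ) 0 * max (1 - γp) 0 : ℝ) : EReal)) ∧
    -- the orders of magnitude, with a numerical constant `C`
    (∃ C : ℝ, 0 < C ∧ ∀ (d n : ℕ) (κ ε : ℝ), 1 < κ → 0 < ε → ε ≤ 1 →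
      SampleSizeCondition d n κ ε →
        (deltaHat d n κ ε + gammaMinus d n κ ε) / (1 + deltaHat d n κ ε) ≤
          C * (κ / (κ - 1)) * deltaHat d n κ ε ∧
        deltaHat d n κ ε ≤ C * √(κ * (d + Real.log ε⁻¹) / n)) := by
  refine ⟨?_, 400, by norm_num, ?_⟩
  · intro Ω _ Pr _ d n P _ X κ ε hlaw hind hP hκ hκP hε hs
    -- For ε ≥ 1/2 the empty event suffices; otherwise log ε⁻¹ > 0, so `confTerm` is positive even
    -- when d = 0.
    rcases le_or_gt (1 / 2) ε with hε2 | hε2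
    · refine ⟨∅, MeasurableSet.empty, ?_, fun ω hω => absurd hω (Set.notMem_empty ω)⟩
      rw [measureReal_empty]
      linarith
    have hL : 0 < confTerm d ε := by
      have h1 : 0 < Real.log ε⁻¹ := Real.log_pos ((one_lt_inv₀ hε).2 (by linarith))
      have h2 : (0 : ℝ) ≤ d := Nat.cast_nonneg d
      unfold confTerm
      linarith
    obtain ⟨A, hA, hAP, hAb⟩ := exists_deviation_event (n := n) hP hκ hκP hε hL hs
    have hXm : ∀ i, AEMeasurable (X i) Pr := fun i => (hlaw i).aemeasurable
    have hmap : Pr.map (fun ω i => X i ω) = Measure.pi fun _ : Fin n => P := by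
      rw [hind.map_fun_eq_pi_map hXm]
      congr 1
      ext1 i
      exact (hlaw i).map_eq
    -- The sample is only almost everywhere measurable, so the preimage is replaced by a measurable
    -- subset of the same probability.
    obtain ⟨B, hB, hBA, hBP⟩ := exists_measurableSet_preimage
      (aemeasurable_pi_lambda (fun ω i => X i ω) hXm) hA
    refine ⟨B, hB, ?_, fun ω hω θ => ?_⟩
    · have h1 : Pr.real B = (Measure.pi fun _ : Fin n => P).real A := by
        rw [measureReal_def, hBP, hmap, measureReal_def]
      have h2 : (Measure.pi fun _ : Fin n => P).real Aᶜ ≤ 2 * ε :=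
        ENNReal.toReal_le_of_le_ofReal (by linarith) hAP
      rw [probReal_compl_eq_one_sub hA] at h2
      linarith
    · obtain ⟨hreg, hθ⟩ := hAb _ (hBA hω)
      obtain ⟨dp, dm, q, r, hdp, hdm, hq, hr, hdp0, h1, h2, h3, h4, h5, h6⟩ :=
        deviation_bounds (θ := θ) hP hκ hL hs hreg (fun h => (hθ θ h).1) fun h => (hθ θ h).2
      have hγp : 0 ≤ gammaPlus P κ ε fun i => X i ω := by
        rw [gammaPlus_eq hκ hL.le]; positivity
      simp only [hdp, hdm, hq, hr]
      refine ⟨?_, EReal.coe_le_coe_iff.2 h3,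
        ratio_chain (deltaHat_pos hκ hL hs) hγp hdp0 h1 h2 h3 h4 h5 h6⟩
      rw [← EReal.coe_mul]
      exact EReal.coe_le_coe_iff.2 h4
  · intro d n κ ε hκ hε hε1 hs
    have hL : 0 ≤ confTerm d ε := by
      have h1 : 0 ≤ Real.log ε⁻¹ := Real.log_nonneg ((one_le_inv₀ hε).2 hε1)
      unfold confTerm
      positivity
    refine ⟨(lower_bound_order hκ hL hs).trans ?_, deltaHat_order hκ hε hε1 hs⟩
    have hκ' : 0 < κ - 1 := sub_pos.2 hκ
    have hδ : 0 ≤ deltaHat d n κ ε := mu_nonneg.trans (mu_le_deltaHat hκ hs)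
    gcongr
    norm_num
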